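/- Let $a<0$, $\beta=0$, $\gamma>0$, and let $\Omega,p,\lambda_M,\lambda_M',\lambda_E,\lambda_E'$ be real numbers with $$\gamma\,|\sinh\Omega\pi|<-5a\Omega^2\pi .$$ Consider the advance–delay system $$\begin{aligned} U''(z)+U(z)+aU(z)^2+\beta U(z)^3&=\varepsilon\bigl(-\lambda_M'V''(z-p)-\lambda_MV''(z)-\lambda_E'V(z-p)-\lambda_EV(z)-\gamma U'(z)+\sin\Omega z\bigr),\\ V''(z)+V(z)+aV(z)^2+\beta V(z)^3&=\varepsilon\bigl(-\lambda_MU''(z)-\lambda_M'U''(z+p)-\lambda_EU(z)-\lambda_E'U(z+p)+\gamma V'(z)+\sin\Omega z\bigr) \end{aligned}\tag{1}$$ for $z\in\mathbb R$. Put $q(z)=-\frac1a+\frac{3}{2a}\operatorname{sech}^2\frac z2$ and $\mathfrak p=q'$, and let $$\begin{aligned} M_1(\tau_1,\tau_2)&=\int_{\mathbb R}\mathfrak p(z-\tau_1)\bigl[-\lambda_M'\mathfrak p'(z-\tau_2-p)-\lambda_M\mathfrak p'(z-\tau_2)-\lambda_E'q(z-\tau_2-p)-\lambda_Eq(z-\tau_2)-\gamma\mathfrak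 p(z-\tau_1)+\sin\Omega z\bigr]dz,\\ M_2(\tau_1,\tau_2)&=\int_{\mathbb R}\mathfrak p(z-\tau_2)\bigl[-\lambda_M\mathfrak p'(z-\tau_1)-\lambda_M'\mathfrak p'(z-\tau_1+p)-\lambda_Eq(z-\tau_1)-\lambda_E'q(z-\tau_1+p)+\gamma\mathfrak p(z-\tau_2)+\sin\Omega z\bigr]dz . \end{aligned}$$ Further let $M_{12}=M_{22}=\int_{\mathbb R}\mathfrak p(z)\sin\Omega z\,dz$, let $$\begin{aligned} M_{11}(\eta)&=\int_{\mathbb R}\mathfrak p(z)\bigl[-\lambda_M'\mathfrak p'(z+\eta-p)-\lambda_M\mathfrak p'(z+\eta)-\lambda_E'q(z+\eta-p)-\lambda_Eq(z+\eta)-\gamma\mathfrak p(z)\bigr]dz,\\ M_{21}(\eta)&=\int_{\mathbb R}\mathfrak p(z)\bigl[-\lambda_M\mathfrak p'(z-\eta)-\lambda_M'\mathfrak p'(z-\eta+p)-\lambda_Eq(z-\eta)-\lambda_E'q(z-\eta+p)+\gamma\mathfrak p(z)\bigr]dz, \end{aligned}$$ and $$M(\eta)=M_{21}(\eta)^2M_{12}^2\sin^2\Omega\eta+\bigl(M_{11}(\eta)M_{22}-M_{12}M_{21}(\eta)\cos\Omega\eta\bigr)^2-M_{12}^2M_{22}^2\sin^2\Omega\eta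 .$$ Say that the homoclinic orbit with shifts $(\tau_1,\tau_2)$ persists if there are $\varepsilon_0>0$ and $C$ such that for every $\varepsilon$ with $0<|\varepsilon|<\varepsilon_0$ the system (1) has a $\frac{2\pi}{\Omega}$-periodic $C^2$ solution $(\bar U,\bar V)$ and a $C^2$ solution $(U,V)$ on $\mathbb R$ such that, for all $z$, $(\bar U',\bar U,\bar V',\bar V)(z)$ is within $C|\varepsilon|$ of $(0,-\frac1a,0,-\frac1a)$, $(U',U,V',V)(z)$ is within $C|\varepsilon|$ of $(\mathfrak p(z-\tau_1),q(z-\tau_1),\mathfrak p(z-\tau_2),q(z-\tau_2))$, and $(U',U,V',V)(z)-(\bar U',\bar U,\bar V',\bar V)(z)\to0$ as $z\to\pm\infty$. A zero of $(M_1,M_2)$ is simple if the Jacobian matrix there is invertible; a zero of $M$ is simple if $M'\neq0$ there. Then: 1. there is a simple zero $(\tau_1,\tau_2)$ of $(M_1,M_2)$ for which the homoclinic orbit with shifts $(\tau_1,\tau_2)$ persists; 2. for every simple zero $(\tau_1,\tau_2)$ of $(M_1,M_2)$ the homoclinic orbit with shifts $(\tau_1,\tau_2)$ persists; 3. $M$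 has infinitely many simple zeros, and they are unbounded above and unbounded below; 4. for every simple zero $\eta$ of $M$ there is $\tau_2$ such that $(\eta+\tau_2,\tau_2)$ is a simple zero of $(M_1,M_2)$. -/

import Mathlib

open Filter Topology

noncomputable section

/-- The real parameters of the system: nonlinear coefficients `a`, `β`, gain/loss coefficient `γ`,
driving frequency `Ω`, spatial shift `p`, magnetic interaction coefficients `lamM`, `lamM'` and
electric interaction coefficients `lamE`, `lamE'`. -/
structure PTParams where
  a : ℝ
  β : ℝ
  γ : ℝ
  Ω : ℝ
  p : ℝ
  lamM : ℝ
  lamM' : ℝ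
  lamE : ℝ
  lamE' : ℝ

namespace PTParams

variable (P : PTParams)

/-- `(U, V)` is a classical solution on the whole line of the weakly coupled, weakly forced
advance-delay system with small parameter `ε`. -/
structure IsSolution (ε : ℝ) (U V : ℝ → ℝ) : Prop where
  contDiff_U : ContDiff ℝ 2 U
  contDiff_V : ContDiff ℝ 2 V
  eq_U : ∀ z : ℝ, deriv (deriv U) z + U z + P.a * U z ^ 2 + P.β * U z ^ 3 =
    ε * (-P.lamM' * deriv (deriv V) (z - P.p) - P.lamM * deriv (deriv V) z
      - P.lamE' * V (z - P.p) - P.lamE * V z - P.γ * deriv U z + Real.sin (P.Ω * z))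
  eq_V : ∀ z : ℝ, deriv (deriv V) z + V z + P.a * V z ^ 2 + P.β * V z ^ 3 =
    ε * (-P.lamM * deriv (deriv U) z - P.lamM' * deriv (deriv U) (z + P.p)
      - P.lamE * U z - P.lamE' * U (z + P.p) + P.γ * deriv V z + Real.sin (P.Ω * z))

/-- The homoclinic solution `-1/a + 3 sech²(z/2) / (2a)` of `q'' + q + a q² = 0`. -/
def qh (z : ℝ) : ℝ := -1 / P.a + 3 / (2 * P.a * Real.cosh (z / 2) ^ 2)

/-- Its derivative `-3 sech²(z/2) tanh(z/2) / (2a)`. -/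
def ph (z : ℝ) : ℝ := -(3 * Real.tanh (z / 2)) / (2 * P.a * Real.cosh (z / 2) ^ 2)

/-- The point `(U', U, V', V)` of the phase space `ℝ⁴` at `z`. -/
def phase (U V : ℝ → ℝ) (z : ℝ) : ℝ × ℝ × ℝ × ℝ := (deriv U z, U z, deriv V z, V z)

/-- The homoclinic trajectory of the uncoupled system, with the two components shifted by
`τ₁` and `τ₂`. -/
def homoclinic (τ₁ τ₂ z : ℝ) : ℝ × ℝ × ℝ × ℝ :=
  (P.ph (z - τ₁), P.qh (z - τ₁), P.ph (z - τ₂), P.qh (z - τ₂))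

/-- The hyperbolic equilibrium of the uncoupled system. -/
def equilibrium : ℝ × ℝ × ℝ × ℝ := (0, -1 / P.a, 0, -1 / P.a)

/-- The homoclinic trajectory with shifts `τ₁`, `τ₂` persists: for all small `ε ≠ 0` the
hyperbolic equilibrium continues to a solution `(Ub, Vb)` with the period `2π/Ω` of the forcing,
`O(ε)`-close to the equilibrium, and the system has a solution `(U, V)` that is homoclinic to
`(Ub, Vb)` and `O(ε)`-close in `ℝ⁴` to the homoclinic trajectory, uniformly on the line. -/
def Persists (τ₁ τ₂ : ℝ) : Prop :=
  ∃ ε₀ > 0, ∃ C : ℝ, ∀ ε : ℝ, 0 < |ε| → |ε| < ε₀ →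
    ∃ U V Ub Vb : ℝ → ℝ,
      P.IsSolution ε U V ∧
      P.IsSolution ε Ub Vb ∧
      Function.Periodic Ub (2 * Real.pi / P.Ω) ∧
      Function.Periodic Vb (2 * Real.pi / P.Ω) ∧
      (∀ z : ℝ, ‖phase Ub Vb z - P.equilibrium‖ ≤ C * |ε|) ∧
      (∀ z : ℝ, ‖phase U V z - P.homoclinic τ₁ τ₂ z‖ ≤ C * |ε|) ∧
      Tendsto (fun z => phase U V z - phase Ub Vb z) atTop (𝓝 0) ∧
      Tendsto (fun z => phase U V z - phase Ub Vb z) atBot (𝓝 0)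

/-- The first Melnikov function. -/
def melnikov₁ (τ₁ τ₂ : ℝ) : ℝ :=
  ∫ z : ℝ, P.ph (z - τ₁) *
    (-P.lamM' * deriv P.ph (z - τ₂ - P.p) - P.lamM * deriv P.ph (z - τ₂)
      - P.lamE' * P.qh (z - τ₂ - P.p) - P.lamE * P.qh (z - τ₂)
      - P.γ * P.ph (z - τ₁) + Real.sin (P.Ω * z))

/-- The second Melnikov function. -/
def melnikov₂ (τ₁ τ₂ : ℝ) : ℝ :=
  ∫ z : ℝ, P.ph (z - τ₂) *
    (-P.lamM * deriv P.ph (z - τ₁) - P.lamM' * deriv P.ph (z - τ₁ + P.p)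
      - P.lamE * P.qh (z - τ₁) - P.lamE' * P.qh (z - τ₁ + P.p)
      + P.γ * P.ph (z - τ₂) + Real.sin (P.Ω * z))

/-- `(τ₁, τ₂)` is a simple zero of the pair of Melnikov functions: both vanish there and the
derivative of the pair exists there and is invertible. -/
def IsSimpleMelnikovZero (τ₁ τ₂ : ℝ) : Prop :=
  P.melnikov₁ τ₁ τ₂ = 0 ∧ P.melnikov₂ τ₁ τ₂ = 0 ∧
    ∃ L : (ℝ × ℝ) ≃L[ℝ] (ℝ × ℝ),
      HasFDerivAt (fun τ : ℝ × ℝ => (P.melnikov₁ τ.1 τ.2, P.melnikov₂ τ.1 τ.2))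
        (L : (ℝ × ℝ) →L[ℝ] (ℝ × ℝ)) (τ₁, τ₂)

/-- Coupling and damping part of the first Melnikov function, as a function of `η = τ₁ - τ₂`. -/
def M₁₁ (η : ℝ) : ℝ :=
  ∫ z : ℝ, P.ph z *
    (-P.lamM' * deriv P.ph (z + η - P.p) - P.lamM * deriv P.ph (z + η)
      - P.lamE' * P.qh (z + η - P.p) - P.lamE * P.qh (z + η) - P.γ * P.ph z)

/-- Amplitude of the forcing part `M₁₂ cos(Ω τ₁)` of the first Melnikov function. -/
def M₁₂ : ℝ := ∫ z : ℝ, P.ph z * Real.sin (P.Ω * z)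

/-- Coupling and gain part of the second Melnikov function, as a function of `η = τ₁ - τ₂`. -/
def M₂₁ (η : ℝ) : ℝ :=
  ∫ z : ℝ, P.ph z *
    (-P.lamM * deriv P.ph (z - η) - P.lamM' * deriv P.ph (z - η + P.p)
      - P.lamE * P.qh (z - η) - P.lamE' * P.qh (z - η + P.p) + P.γ * P.ph z)

/-- Amplitude of the forcing part `M₂₂ cos(Ω τ₂)` of the second Melnikov function. -/
def M₂₂ : ℝ := ∫ z : ℝ, P.ph z * Real.sin (P.Ω * z)

/-- The reduced function `M(η)`, obtained by eliminating `τ₂`. -/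
def reduced (η : ℝ) : ℝ :=
  P.M₂₁ η ^ 2 * P.M₁₂ ^ 2 * Real.sin (P.Ω * η) ^ 2
    + (P.M₁₁ η * P.M₂₂ - P.M₁₂ * P.M₂₁ η * Real.cos (P.Ω * η)) ^ 2
    - P.M₁₂ ^ 2 * P.M₂₂ ^ 2 * Real.sin (P.Ω * η) ^ 2

/-- `η` is a simple zero of the reduced function. -/
def IsSimpleReducedZero (η : ℝ) : Prop :=
  P.reduced η = 0 ∧ DifferentiableAt ℝ P.reduced η ∧ deriv P.reduced η ≠ 0

end PTParams

end

/-! The proof is a Lyapunov–Schmidt reduction in spaces of bounded continuous functions. Put `U = (q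
+ εX)(· - τ₁)`, `V = (q + εY)(· - τ₂)` and centre each equation at its own pulse. Since `2aq = -2 +
3 sech²(z/2)`, this gives `LX = N₁ + εR₁(X, Y)`, `LY = N₂ + εR₂(X, Y)` with `L u = u'' - u + 3
sech²(z/2) u`. Here `N` (`inhom`) is the perturbation evaluated on the unperturbed orbit, and `R`
(`remainder`) is the linear coupling minus `a` times the squares. The coupling contains shifted
second derivatives, so the unknowns are jets `(u, u', u'')` generated from right-hand sides by
bounded inverses. Shifts are then bounded operators and no regularity is lost.

The operator `L` is symmetric, and its bounded kernel is spanned by `st = sech² tanh`, a multiple of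
`q'`. Solvability at leading order, `∫ st Nᵢ = 0`, says `M₁ = M₂ = 0`. At the next order, `∫ st Rᵢ =
0` has to determine the amplitudes `α` of the kernel functions in `X` and `Y`. It is affine in `α`
because `∫ st³ = 0`, and Green's identity with `L st' = 3 st²` identifies its linear part with
`2a/3` times the Jacobian of `(M₁, M₂)` (`solv_remainder_component`). If the Jacobian is invertible,
the implicit function theorem yields right-hand sides and amplitudes together, with `τ₁, τ₂` held
fixed (`exists_homoclinic_branch`). Around the equilibrium the operator is `u'' - u`, which has no
bounded kernel, and local uniqueness makes the branch periodic (`exists_periodic_branch`). Far out,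
the difference of the two solutions obeys `D'' - D = small`, where every eventual bound can be
halved, so it tends to zero.

For the zeros of `M`, let `m = M₁₂` and let `g` be the damping integral `damp`. As `η → ±∞` the
coupling correlations die out and `M₁₁ → -g`, `M₂₁ → g`, with derivatives tending to zero. So `M`
approaches `m² (1 + cos θ)(2g² - m² (1 - cos θ))`, `θ = Ωη`, which has a transversal zero at `cos θ
= 1 - 2g²/m²` when `0 < g < |m|`. By the Fourier transform of `sech²`, the inequality `g < |m|` is
exactly the hypothesis (`damp_lt`). Transversal zeros survive the approach to the limit in every far
period. Finally, a zero of `M` supplies consistent values of `cos Ωτ₂` and `sin Ωτ₂`, and `Ω M'` is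
a nonzero multiple of the Jacobian determinant there. -/

open MeasureTheory Set

noncomputable section

/-! ### The profile functions of the soliton -/

/-- The function `tanh (z / 2)`. -/
def th (z : ℝ) : ℝ := Real.tanh (z / 2)

/-- The function `sech² (z / 2)`. -/
def sc (z : ℝ) : ℝ := 1 / Real.cosh (z / 2) ^ 2

theorem sc_eq (z : ℝ) : sc z = 1 - th z ^ 2 := by
  have := Real.cosh_pos (z / 2)
  have h2 := Real.cosh_sq (z / 2)
  rw [sc, th, Real.tanh_eq_sinh_div_cosh]
  field_simp
  linarith

theorem hasDerivAt_th (z : ℝ) : HasDerivAt th (sc z / 2) z := by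
  have hc : Real.cosh (z / 2) ≠ 0 := (Real.cosh_pos (z / 2)).ne'
  have hz : HasDerivAt (fun z : ℝ => z / 2) (1 / 2) z := (hasDerivAt_id z).div_const 2
  have h : HasDerivAt (fun z => Real.sinh (z / 2) / Real.cosh (z / 2)) _ z :=
    hz.sinh.fun_div hz.cosh hc
  have h2 := Real.cosh_sq (z / 2)
  have e : th = fun z => Real.sinh (z / 2) / Real.cosh (z / 2) := by
    funext x; simp [th, Real.tanh_eq_sinh_div_cosh]
  rw [e]
  convert h using 1
  simp only [sc]
  field_simp
  linarith

theorem hasDerivAt_sc (z : ℝ) : HasDerivAt sc (-(sc z * th z)) z := by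
  have h : HasDerivAt (fun z => 1 - th z ^ 2) _ z := ((hasDerivAt_th z).fun_pow 2).const_sub 1
  rw [← funext sc_eq] at h
  convert h using 1
  push_cast; ring

theorem continuous_th : Continuous th :=
  continuous_iff_continuousAt.2 fun z => (hasDerivAt_th z).continuousAt

theorem continuous_sc : Continuous sc :=
  continuous_iff_continuousAt.2 fun z => (hasDerivAt_sc z).continuousAt

theorem abs_th_le_one (z : ℝ) : |th z| ≤ 1 := (Real.abs_tanh_lt_one _).le

theorem sc_pos (z : ℝ) : 0 < sc z := by
  have := Real.cosh_pos (z / 2)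
  unfold sc; positivity

theorem sc_le_one (z : ℝ) : sc z ≤ 1 := by
  rw [sc_eq]; nlinarith [sq_nonneg (th z)]

theorem abs_sc (z : ℝ) : |sc z| = sc z := abs_of_pos (sc_pos z)

theorem th_neg (z : ℝ) : th (-z) = -th z := by
  simp [th, neg_div, Real.tanh_neg]

theorem sc_neg (z : ℝ) : sc (-z) = sc z := by
  simp [sc, neg_div]

theorem tendsto_cosh_atTop : Tendsto Real.cosh atTop atTop := by
  refine tendsto_atTop_mono (f := fun x => Real.exp x / 2) (fun x => ?_)
    (Real.tendsto_exp_atTop.atTop_div_const (by norm_num))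
  rw [Real.cosh_eq]; have := Real.exp_pos (-x); linarith

theorem tendsto_sc_atTop : Tendsto sc atTop (𝓝 0) := by
  have h : Tendsto (fun z : ℝ => Real.cosh (z / 2) ^ 2) atTop atTop :=
    (tendsto_pow_atTop (by norm_num)).comp
      (tendsto_cosh_atTop.comp (tendsto_id.atTop_div_const (by norm_num)))
  have := h.inv_tendsto_atTop
  refine this.congr fun z => ?_
  simp [sc]

theorem tendsto_sc_atBot : Tendsto sc atBot (𝓝 0) := by
  have := tendsto_sc_atTop.comp tendsto_neg_atBot_atTop
  exact this.congr fun z => sc_neg z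

/-- On the positive half-line `th = √(1 - sc)`. -/
theorem tendsto_th_atTop : Tendsto th atTop (𝓝 1) := by
  have h : Tendsto (fun z => Real.sqrt (1 - sc z)) atTop (𝓝 (Real.sqrt (1 - 0))) :=
    (Real.continuous_sqrt.tendsto _).comp (tendsto_sc_atTop.const_sub 1)
  simp only [sub_zero, Real.sqrt_one] at h
  refine h.congr' ?_
  filter_upwards [eventually_ge_atTop 0] with z hz
  rw [sc_eq, sub_sub_cancel, Real.sqrt_sq]
  unfold th
  rw [Real.tanh_eq_sinh_div_cosh]
  exact div_nonneg (Real.sinh_nonneg_iff.2 (by linarith)) (Real.cosh_pos _).le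

theorem tendsto_th_atBot : Tendsto th atBot (𝓝 (-1)) := by
  have := (tendsto_th_atTop.comp tendsto_neg_atBot_atTop).neg
  exact this.congr fun z => by simp [th_neg]

/-- A nonnegative function with the convergent antiderivative `2 th`; the left half follows by
evenness. -/
theorem integrable_sc : Integrable sc := by
  have hd : ∀ x, HasDerivAt (fun z => 2 * th z) (sc x) x := fun x =>
    ((hasDerivAt_th x).const_mul 2).congr_deriv (by ring)
  have h1 : IntegrableOn sc (Ioi 0) :=
    integrableOn_Ioi_deriv_of_nonneg' (fun x _ => hd x) (fun x _ => (sc_pos x).le)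
      (tendsto_th_atTop.const_mul 2)
  have h2 : IntegrableOn sc (Iic 0) := by
    have h3 : IntegrableOn sc (Ici (-0)) := by
      rw [neg_zero]; exact (integrableOn_Ici_iff_integrableOn_Ioi).2 h1
    have := h3.comp_neg_Iic
    exact this.congr_fun (fun z _ => sc_neg z) measurableSet_Iic
  have := h2.union h1
  rwa [Iic_union_Ioi, integrableOn_univ] at this

theorem integral_of_antideriv {F f : ℝ → ℝ} {m n : ℝ} (hd : ∀ x, HasDerivAt F (f x) x)
    (hi : Integrable f) (hb : Tendsto F atBot (𝓝 m)) (ht : Tendsto F atTop (𝓝 n)) :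
    ∫ x, f x = n - m :=
  integral_of_hasDerivAt_of_tendsto hd hi hb ht

theorem integrable_sc_mul {f : ℝ → ℝ} (hf : Continuous f) {C : ℝ} (hC : ∀ z, |f z| ≤ C) :
    Integrable fun z => sc z * f z :=
  integrable_sc.mul_bdd hf.aestronglyMeasurable (ae_of_all _ hC)

/-! ### Bounded operators on the space of bounded continuous functions -/

/-- Bounded continuous real functions on the line, with the supremum norm. -/
abbrev BC := BoundedContinuousFunction ℝ ℝ

theorem BC.abs_le (f : BC) (z : ℝ) : |f z| ≤ ‖f‖ := f.norm_coe_le_norm z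

/-- A uniformly bounded linear family of continuous functions as a bounded operator. -/
def opOfBound (A : BC → ℝ → ℝ) (hadd : ∀ f g z, A (f + g) z = A f z + A g z)
    (hsmul : ∀ (c : ℝ) f z, A (c • f) z = c * A f z) (hcont : ∀ f, Continuous (A f)) (C : ℝ)
    (hb : ∀ f z, |A f z| ≤ C * ‖f‖) : BC →L[ℝ] BC :=
  LinearMap.mkContinuous
    { toFun := fun f => BoundedContinuousFunction.ofNormedAddCommGroup (A f) (hcont f) (C * ‖f‖)
        (hb f)
      map_add' := fun f g => by ext z; simpa using hadd f g z
      map_smul' := fun c f => by ext z; simpa using hsmul c f z } C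
    (fun f => by
      refine BoundedContinuousFunction.norm_ofNormedAddCommGroup_le _ ?_ (hb f)
      exact (abs_nonneg _).trans (hb f 0))

/-- Translation of functions: `shift b f z = f (z + b)`. -/
def shift (b : ℝ) : BC →L[ℝ] BC :=
  opOfBound (fun f z => f (z + b)) (fun _ _ _ => rfl) (fun _ _ _ => rfl)
    (fun f => f.continuous.comp (continuous_add_const b)) 1 fun f z => by
      simpa using f.abs_le (z + b)

@[simp] theorem shift_apply (b : ℝ) (f : BC) (z : ℝ) : shift b f z = f (z + b) := rfl

theorem norm_shift_le (b : ℝ) (f : BC) : ‖shift b f‖ ≤ ‖f‖ :=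
  (BoundedContinuousFunction.norm_le (norm_nonneg f)).2 fun z => f.abs_le (z + b)

/-- Reflection of functions. -/
def refl' : BC →L[ℝ] BC :=
  opOfBound (fun f z => f (-z)) (fun _ _ _ => rfl) (fun _ _ _ => rfl)
    (fun f => f.continuous.comp continuous_neg) 1 fun f z => by
      simpa using f.abs_le (-z)

@[simp] theorem refl'_apply (f : BC) (z : ℝ) : refl' f z = f (-z) := rfl

theorem BC.integrable_mul {φ : ℝ → ℝ} (hφ : Integrable φ) (f : BC) :
    Integrable fun z => φ z * f z :=
  hφ.mul_bdd f.continuous.aestronglyMeasurable (ae_of_all _ f.abs_le)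

/-- Integration against an integrable function. -/
def pairing (φ : ℝ → ℝ) (hφ : Integrable φ) : BC →L[ℝ] ℝ :=
  LinearMap.mkContinuous
    { toFun := fun f => ∫ z, φ z * f z
      map_add' := fun f g => by
        rw [← integral_add (f.integrable_mul hφ) (g.integrable_mul hφ)]
        exact integral_congr_ae (ae_of_all _ fun z => by simp [mul_add])
      map_smul' := fun c f => by
        simp only [RingHom.id_apply, smul_eq_mul]
        rw [← integral_const_mul]
        exact integral_congr_ae (ae_of_all _ fun z => by
          simp only [BoundedContinuousFunction.coe_smul, smul_eq_mul]; ring) }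
    (∫ z, |φ z|)
    (fun f => by
      rw [← integral_mul_const]
      refine norm_integral_le_of_norm_le (hφ.abs.mul_const _) (ae_of_all _ fun z => ?_)
      rw [norm_mul]
      exact mul_le_mul_of_nonneg_left (f.abs_le z) (abs_nonneg _))

@[simp] theorem pairing_apply (φ : ℝ → ℝ) (hφ : Integrable φ) (f : BC) :
    pairing φ hφ f = ∫ z, φ z * f z := rfl

theorem hasDerivAt_integral_Iic {g : ℝ → ℝ} (hg : Continuous g) (hi : ∀ z, IntegrableOn g (Iic z))
    (z : ℝ) : HasDerivAt (fun z => ∫ y in Iic z, g y) (g z) z := by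
  have h := (hg.integral_hasStrictDerivAt 0 z).hasDerivAt.const_add (∫ y in Iic 0, g y)
  refine h.congr_of_eventuallyEq (Eventually.of_forall fun y => ?_)
  have := intervalIntegral.integral_Iic_sub_Iic (hi 0) (hi y)
  simp only
  linarith

/-! ### Solving `u'' - u = f` -/

theorem integrableOn_exp_mul (f : BC) (z : ℝ) :
    IntegrableOn (fun y => Real.exp y * f y) (Iic z) :=
  (integrableOn_exp_Iic z).mul_bdd f.continuous.aestronglyMeasurable
    (ae_of_all _ f.abs_le)

theorem hasDerivAt_expInt (f : BC) (z : ℝ) :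
    HasDerivAt (fun z => Real.exp (-z) * ∫ y in Iic z, Real.exp y * f y)
      (f z - Real.exp (-z) * ∫ y in Iic z, Real.exp y * f y) z := by
  have h1 := hasDerivAt_integral_Iic (g := fun y => Real.exp y * f y)
    (Real.continuous_exp.mul f.continuous) (integrableOn_exp_mul f) z
  have h2 : HasDerivAt (fun z : ℝ => Real.exp (-z)) (-Real.exp (-z)) z := by
    simpa using (hasDerivAt_neg z).exp
  refine (h2.mul h1).congr_deriv ?_
  have : Real.exp (-z) * Real.exp z = 1 := by rw [← Real.exp_add]; simp
  linear_combination f z * this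

/-- The bounded solution operator of `v' = f - v`. -/
def expInt : BC →L[ℝ] BC :=
  opOfBound (fun f z => Real.exp (-z) * ∫ y in Iic z, Real.exp y * f y)
    (fun f g z => by
      rw [← mul_add, ← integral_add (integrableOn_exp_mul f z) (integrableOn_exp_mul g z)]
      simp [mul_add])
    (fun c f z => by
      simp only [BoundedContinuousFunction.coe_smul, smul_eq_mul, mul_left_comm _ c,
        integral_const_mul])
    (fun f => continuous_iff_continuousAt.2 fun z => (hasDerivAt_expInt f z).continuousAt) 1
    fun f z => by
      rw [abs_mul, abs_of_pos (Real.exp_pos _), one_mul]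
      have h : ‖∫ y in Iic z, Real.exp y * f y‖ ≤ ∫ y in Iic z, Real.exp y * ‖f‖ := by
        have hi : Integrable (fun y => Real.exp y * ‖f‖) (volume.restrict (Iic z)) :=
          Integrable.mul_const (integrableOn_exp_Iic z) ‖f‖
        refine norm_integral_le_of_norm_le hi (ae_of_all _ fun y => ?_)
        rw [norm_mul, Real.norm_eq_abs, abs_of_pos (Real.exp_pos _)]
        exact mul_le_mul_of_nonneg_left (f.abs_le y) (Real.exp_pos _).le
      rw [integral_mul_const, integral_exp_Iic] at h
      calc _ ≤ Real.exp (-z) * (Real.exp z * ‖f‖) :=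
            mul_le_mul_of_nonneg_left h (Real.exp_pos _).le
        _ = ‖f‖ := by rw [← mul_assoc, ← Real.exp_add]; simp

theorem hasDerivAt_expInt_apply (f : BC) (z : ℝ) :
    HasDerivAt (expInt f) (f z - expInt f z) z := hasDerivAt_expInt f z

/-- Commutation with translations is what later makes the branch at the equilibrium periodic. -/
theorem expInt_shift (b : ℝ) (f : BC) : expInt (shift b f) = shift b (expInt f) := by
  ext z
  change Real.exp (-z) * ∫ y in Iic z, Real.exp y * f (y + b) =
    Real.exp (-(z + b)) * ∫ y in Iic (z + b), Real.exp y * f y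
  have h := (measurePreserving_add_right volume b).setIntegral_preimage_emb
    (measurableEmbedding_addRight b) (fun y => Real.exp y * f y) (Iic (z + b))
  simp only [preimage_add_const_Iic, add_sub_cancel_right] at h
  rw [← h, neg_add, Real.exp_add, mul_assoc, ← integral_const_mul (Real.exp (-b))]
  congr 2
  funext y
  have e : Real.exp (-b) * Real.exp (y + b) = Real.exp y := by
    rw [← Real.exp_add]; congr 1; ring
  rw [← mul_assoc, e]

/-- The bounded solution operator of `v' = v - f`. -/
def expInt' : BC →L[ℝ] BC := refl' ∘L expInt ∘L refl'

theorem hasDerivAt_expInt'_apply (f : BC) (z : ℝ) :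
    HasDerivAt (expInt' f) (expInt' f z - f z) z := by
  have h := (hasDerivAt_expInt_apply (refl' f) (-z)).comp z (hasDerivAt_neg z)
  refine h.congr_deriv ?_
  simp [expInt']

theorem refl'_shift (b : ℝ) (f : BC) : refl' (shift b f) = shift (-b) (refl' f) := by
  ext z; simp [add_comm]

theorem expInt'_shift (b : ℝ) (f : BC) : expInt' (shift b f) = shift b (expInt' f) := by
  simp [expInt', refl'_shift, expInt_shift]

/-- The bounded solution operator of `u'' - u = f`. -/
def invK : BC →L[ℝ] BC := (-(1 / 2 : ℝ)) • (expInt' + expInt)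

/-- The derivative of `invK`. -/
def invK' : BC →L[ℝ] BC := (-(1 / 2 : ℝ)) • (expInt' - expInt)

/-- The two exponential integrals together are convolution with the Green function `-e^{-|z|}/2`. -/
theorem hasDerivAt_invK (f : BC) (z : ℝ) : HasDerivAt (invK f) (invK' f z) z := by
  have h := ((hasDerivAt_expInt'_apply f z).add (hasDerivAt_expInt_apply f z)).const_mul
    (-(1 / 2 : ℝ))
  exact h.congr_deriv (by simp [invK'])

theorem hasDerivAt_invK' (f : BC) (z : ℝ) : HasDerivAt (invK' f) (invK f z + f z) z := by
  have h := ((hasDerivAt_expInt'_apply f z).sub (hasDerivAt_expInt_apply f z)).const_mul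
    (-(1 / 2 : ℝ))
  exact h.congr_deriv (by simp [invK]; ring)

theorem invK_shift (b : ℝ) (f : BC) : invK (shift b f) = shift b (invK f) := by
  simp [invK, expInt_shift, expInt'_shift]

theorem invK'_shift (b : ℝ) (f : BC) : invK' (shift b f) = shift b (invK' f) := by
  simp [invK', expInt_shift, expInt'_shift]

/-! ### Solving `u'' - u + 3 sech² (z / 2) u = f` modulo the cokernel -/

/-- `tanh (z / 2)` as a bounded continuous function. -/
def thB : BC := BoundedContinuousFunction.ofNormedAddCommGroup th continuous_th 1 abs_th_le_one

/-- `sech² (z / 2)` as a bounded continuous function. -/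
def scB : BC := BoundedContinuousFunction.ofNormedAddCommGroup sc continuous_sc 1 fun z => by
  rw [Real.norm_eq_abs, abs_sc]; exact sc_le_one z

@[simp] theorem thB_apply (z : ℝ) : thB z = th z := rfl
@[simp] theorem scB_apply (z : ℝ) : scB z = sc z := rfl

/-- The kernel function of the linearised equation, up to normalisation. -/
def st (z : ℝ) : ℝ := sc z * th z

theorem integrable_st : Integrable st := integrable_sc_mul continuous_th abs_th_le_one

theorem continuous_st : Continuous st := continuous_sc.mul continuous_th

theorem integral_st_sq : ∫ z, st z * st z = 8 / 15 := by
  have hd : ∀ x, HasDerivAt (fun z => 2 * (th z ^ 3 / 3 - th z ^ 5 / 5)) (st x * st x) x :=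
    fun x => by
      have h := ((((hasDerivAt_th x).fun_pow 3).div_const 3).sub
        (((hasDerivAt_th x).fun_pow 5).div_const 5)).const_mul 2
      refine h.congr_deriv ?_
      unfold st
      push_cast
      rw [sc_eq]; ring
  have hi : Integrable fun z => st z * st z := by
    refine integrable_st.mul_bdd continuous_st.aestronglyMeasurable (c := 1)
      (ae_of_all _ fun z => ?_)
    rw [st, norm_mul, Real.norm_eq_abs, abs_sc]
    exact mul_le_one₀ (sc_le_one z) (abs_nonneg _) (abs_th_le_one z)
  have ht := ((((tendsto_th_atTop.pow 3).div_const 3).sub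
    ((tendsto_th_atTop.pow 5).div_const 5)).const_mul 2)
  have hb := ((((tendsto_th_atBot.pow 3).div_const 3).sub
    ((tendsto_th_atBot.pow 5).div_const 5)).const_mul 2)
  rw [integral_of_antideriv hd hi hb ht]
  norm_num

/-- The solvability functional `f ↦ ∫ sech² tanh f`. -/
def solv : BC →L[ℝ] ℝ := pairing st integrable_st

/-- Projection onto the functions satisfying the solvability condition. -/
def projS : BC →L[ℝ] BC :=
  ContinuousLinearMap.id ℝ BC - (15 / 8 : ℝ) • solv.smulRight (scB * thB)

theorem projS_apply (f : BC) (z : ℝ) : projS f z = f z - 15 / 8 * (solv f * st z) := by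
  simp [projS, st]

theorem solv_projS (f : BC) : solv (projS f) = 0 := by
  have h : solv (scB * thB) = 8 / 15 := integral_st_sq
  simp only [projS, sub_apply, smul_apply, map_sub, map_smul, ContinuousLinearMap.id_apply,
    ContinuousLinearMap.smulRight_apply, h, smul_eq_mul]
  ring

theorem projS_of_solv {f : BC} (hf : solv f = 0) : projS f = f := by
  ext z; simp [projS_apply, hf]

theorem integrable_st_mul (f : BC) : Integrable fun z => st z * f z :=
  f.integrable_mul integrable_st

/-- Since `st = -sc'` has constant sign on each half-line, the tail integral of `|st|` is exactly
`sc z`. For `z ≥ 0` the solvability condition replaces the left integral by the right tail. The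
bound compensates the growing factor `1/sc` in `stInt`. -/
theorem abs_integral_st_le {f : BC} (hf : solv f = 0) (z : ℝ) :
    |∫ y in Iic z, st y * f y| ≤ sc z * ‖f‖ := by
  have hd : ∀ x, HasDerivAt (fun z => -sc z) (st x) x := fun x => by
    simpa [st] using (hasDerivAt_sc x).fun_neg
  rcases le_total z 0 with hz | hz
  · have e : ∫ y in Iic z, -st y = sc z := by
      have := integral_Iic_of_hasDerivAt_of_tendsto' (a := z) (m := 0) (f := sc)
        (f' := fun y => -st y) (fun x _ => by simpa [st] using hasDerivAt_sc x)
        integrable_st.neg.integrableOn tendsto_sc_atBot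
      simpa using this
    rw [← e, ← integral_mul_const]
    have hi : Integrable (fun y => -st y * ‖f‖) (volume.restrict (Iic z)) :=
      (integrable_st.neg.mul_const _).integrableOn
    rw [← Real.norm_eq_abs]
    refine norm_integral_le_of_norm_le hi ?_
    filter_upwards [ae_restrict_mem measurableSet_Iic] with y hy
    have hn : th y ≤ 0 := by
      unfold th; rw [Real.tanh_eq_sinh_div_cosh]
      exact div_nonpos_of_nonpos_of_nonneg
        (Real.sinh_nonpos_iff.2 (by linarith [hy.trans hz])) (Real.cosh_pos _).le
    have : |st y| = -st y := abs_of_nonpos (mul_nonpos_of_nonneg_of_nonpos (sc_pos y).le hn)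
    rw [norm_mul, Real.norm_eq_abs, Real.norm_eq_abs, this]
    exact mul_le_mul_of_nonneg_left (f.abs_le y) (this ▸ abs_nonneg _)
  · have e : ∫ y in Ioi z, st y = sc z := by
      have := integral_Ioi_of_hasDerivAt_of_tendsto' (a := z) (fun x _ => hd x)
        integrable_st.integrableOn (by simpa using tendsto_sc_atTop.neg)
      simpa using this
    have hs : ∫ y in Iic z, st y * f y = -∫ y in Ioi z, st y * f y := by
      have h1 := intervalIntegral.integral_Iic_add_Ioi (b := z)
        (integrable_st_mul f).integrableOn (integrable_st_mul f).integrableOn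
      have h2 : ∫ y, st y * f y = 0 := hf
      linarith
    rw [hs, abs_neg, ← e, ← integral_mul_const]
    have hi : Integrable (fun y => st y * ‖f‖) (volume.restrict (Ioi z)) :=
      (integrable_st.mul_const _).integrableOn
    rw [← Real.norm_eq_abs]
    refine norm_integral_le_of_norm_le hi ?_
    filter_upwards [ae_restrict_mem measurableSet_Ioi] with y hy
    have hn : 0 ≤ th y := by
      unfold th; rw [Real.tanh_eq_sinh_div_cosh]
      exact div_nonneg
        (Real.sinh_nonneg_iff.2 (by linarith [hz.trans_lt hy])) (Real.cosh_pos _).le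
    have : |st y| = st y := abs_of_nonneg (mul_nonneg (sc_pos y).le hn)
    rw [norm_mul, Real.norm_eq_abs, Real.norm_eq_abs, this]
    exact mul_le_mul_of_nonneg_left (f.abs_le y) (this ▸ abs_nonneg _)

theorem hasDerivAt_stInt (f : BC) (z : ℝ) :
    HasDerivAt (fun z => (sc z)⁻¹ * ∫ y in Iic z, st y * f y)
      (th z * ((sc z)⁻¹ * ∫ y in Iic z, st y * f y) + th z * f z) z := by
  have h1 := hasDerivAt_integral_Iic (g := fun y => st y * f y)
    (continuous_st.mul f.continuous) (fun z => (integrable_st_mul f).integrableOn) z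
  have hs := (sc_pos z).ne'
  refine (((hasDerivAt_sc z).fun_inv hs).fun_mul h1).congr_deriv ?_
  unfold st
  field_simp

/-- The bounded solution operator of `v' = th v + th f` on functions satisfying the solvability
condition. -/
def stInt : BC →L[ℝ] BC :=
  opOfBound (fun f z => (sc z)⁻¹ * ∫ y in Iic z, st y * projS f y)
    (fun f g z => by
      rw [← mul_add, ← integral_add (integrable_st_mul _).integrableOn
        (integrable_st_mul _).integrableOn]
      simp [mul_add])
    (fun c f z => by
      rw [map_smul]
      simp only [BoundedContinuousFunction.coe_smul, smul_eq_mul, mul_left_comm _ c,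
        integral_const_mul])
    (fun f => continuous_iff_continuousAt.2 fun z => (hasDerivAt_stInt _ z).continuousAt) ‖projS‖
    fun f z => by
      have hs := sc_pos z
      have h := abs_integral_st_le (solv_projS f) z
      rw [abs_mul, abs_inv, abs_sc]
      calc _ ≤ (sc z)⁻¹ * (sc z * ‖projS f‖) := mul_le_mul_of_nonneg_left h (inv_pos.2 hs).le
        _ = ‖projS f‖ := by field_simp
        _ ≤ _ := projS.le_opNorm f

theorem hasDerivAt_stInt_apply (f : BC) (z : ℝ) :
    HasDerivAt (stInt f) (th z * stInt f z + th z * projS f z) z := hasDerivAt_stInt _ z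

theorem continuous_inv_sc_mul (f : BC) : Continuous fun y => (sc y)⁻¹ * f y :=
  (continuous_sc.inv₀ fun z => (sc_pos z).ne').mul f.continuous

theorem inv_sc (z : ℝ) : (sc z)⁻¹ = Real.cosh (z / 2) ^ 2 := by simp [sc]

theorem hasDerivAt_scInt (f : BC) (z : ℝ) :
    HasDerivAt (fun z => sc z * ∫ y in (0 : ℝ)..z, (sc y)⁻¹ * f y)
      (-th z * (sc z * ∫ y in (0 : ℝ)..z, (sc y)⁻¹ * f y) + f z) z := by
  have h1 := ((continuous_inv_sc_mul f).integral_hasStrictDerivAt 0 z).hasDerivAt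
  have hs := (sc_pos z).ne'
  refine ((hasDerivAt_sc z).fun_mul h1).congr_deriv ?_
  field_simp

/-- Uses `cosh²(y/2) ≤ cosh y` under the integral and `|sinh z| ≤ 2 cosh²(z/2)` afterwards. -/
theorem abs_integral_inv_sc_le (f : BC) (z : ℝ) :
    |∫ y in (0 : ℝ)..z, (sc y)⁻¹ * f y| ≤ 2 * (sc z)⁻¹ * ‖f‖ := by
  have hb : ‖∫ y in (0 : ℝ)..z, (sc y)⁻¹ * f y‖ ≤ |∫ y in (0 : ℝ)..z, Real.cosh y * ‖f‖| := by
    refine intervalIntegral.norm_integral_le_abs_of_norm_le (ae_of_all _ fun y => ?_)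
      ((Real.continuous_cosh.mul continuous_const).intervalIntegrable _ _)
    rw [norm_mul, inv_sc, norm_pow, Real.norm_eq_abs, sq_abs]
    refine mul_le_mul ?_ (f.abs_le y) (abs_nonneg _) (Real.cosh_pos _).le
    have h1 := Real.cosh_two_mul (y / 2)
    rw [mul_div_cancel₀ _ two_ne_zero] at h1
    nlinarith [sq_nonneg (Real.sinh (y / 2))]
  have e : ∫ y in (0 : ℝ)..z, Real.cosh y = Real.sinh z := by
    rw [intervalIntegral.integral_eq_sub_of_hasDerivAt (fun x _ => Real.hasDerivAt_sinh x)
      (Real.continuous_cosh.intervalIntegrable _ _)]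
    simp
  refine hb.trans ?_
  rw [intervalIntegral.integral_mul_const, e, abs_mul, abs_norm, inv_sc]
  refine mul_le_mul_of_nonneg_right ?_ (norm_nonneg _)
  have h1 := Real.sinh_two_mul (z / 2)
  rw [mul_div_cancel₀ _ two_ne_zero] at h1
  have h2 := Real.cosh_sq (z / 2)
  have h3 := Real.cosh_pos (z / 2)
  rw [h1, abs_le]
  constructor <;> nlinarith [sq_nonneg (Real.sinh (z / 2) + Real.cosh (z / 2)),
    sq_nonneg (Real.sinh (z / 2) - Real.cosh (z / 2))]

/-- A bounded solution operator of `v' = -th v + f`. -/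
def scInt : BC →L[ℝ] BC :=
  opOfBound (fun f z => sc z * ∫ y in (0 : ℝ)..z, (sc y)⁻¹ * f y)
    (fun f g z => by
      rw [← mul_add, ← intervalIntegral.integral_add
        ((continuous_inv_sc_mul f).intervalIntegrable _ _)
        ((continuous_inv_sc_mul g).intervalIntegrable _ _)]
      simp [mul_add])
    (fun c f z => by
      simp only [BoundedContinuousFunction.coe_smul, smul_eq_mul, mul_left_comm _ c,
        intervalIntegral.integral_const_mul])
    (fun f => continuous_iff_continuousAt.2 fun z => (hasDerivAt_scInt _ z).continuousAt) 2
    fun f z => by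
      have hs := sc_pos z
      have h := abs_integral_inv_sc_le f z
      rw [abs_mul, abs_sc]
      calc _ ≤ sc z * (2 * (sc z)⁻¹ * ‖f‖) := mul_le_mul_of_nonneg_left h hs.le
        _ = _ := by field_simp

theorem hasDerivAt_scInt_apply (f : BC) (z : ℝ) :
    HasDerivAt (scInt f) (-th z * scInt f z + f z) z := hasDerivAt_scInt f z

/-- Multiplication by a fixed bounded continuous function. -/
def mulOp (g : BC) : BC →L[ℝ] BC := ContinuousLinearMap.mul ℝ BC g

@[simp] theorem mulOp_apply (g f : BC) (z : ℝ) : mulOp g f z = g z * f z := rfl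

/-- Auxiliary first-order factor in the solution operator of the linearised equation. -/
def factorW : BC →L[ℝ] BC := scInt ∘L ((5 : ℝ) • stInt + (2 : ℝ) • projS)

/-- Reduction of order, regularised. The ansatz `u = th · w` reduces `L u = f` to `w' = -th w + v /
th²` with `v = stInt f`, singular at the zero of `th`. Passing to `W = w + 2v / th` cancels the
singularity because `1 - sc = th²`, leaving `W' = -th W + 5v + 2f` and `u = th W - 2v`; these are
the coefficients 5 and 2. -/
theorem hasDerivAt_factorW (f : BC) (z : ℝ) :
    HasDerivAt (factorW f) (-th z * factorW f z + (5 * stInt f z + 2 * projS f z)) z :=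
  hasDerivAt_scInt_apply _ z

/-- A bounded right inverse, modulo the cokernel, of `u ↦ u'' - u + 3 sech² (z / 2) u`. -/
def invG : BC →L[ℝ] BC := mulOp thB ∘L factorW - (2 : ℝ) • stInt

/-- The derivative of `invG`. -/
def invG' : BC →L[ℝ] BC :=
  mulOp ((1 / 2 : ℝ) • scB - thB * thB) ∘L factorW + (3 : ℝ) • (mulOp thB ∘L stInt)

theorem invG_apply (f : BC) (z : ℝ) : invG f z = th z * factorW f z - 2 * stInt f z := rfl

theorem invG'_apply (f : BC) (z : ℝ) :
    invG' f z = (1 / 2 * sc z - th z * th z) * factorW f z + 3 * (th z * stInt f z) := rfl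

theorem hasDerivAt_invG (f : BC) (z : ℝ) : HasDerivAt (invG f) (invG' f z) z := by
  have h := ((hasDerivAt_th z).fun_mul (hasDerivAt_factorW f z)).fun_sub
    ((hasDerivAt_stInt_apply f z).const_mul 2)
  refine h.congr_deriv ?_
  rw [invG'_apply]
  ring

theorem hasDerivAt_invG' (f : BC) (z : ℝ) :
    HasDerivAt (invG' f) ((1 - 3 * sc z) * invG f z + projS f z) z := by
  have h := ((((hasDerivAt_sc z).const_mul (1 / 2)).fun_sub
    ((hasDerivAt_th z).fun_mul (hasDerivAt_th z))).fun_mul (hasDerivAt_factorW f z)).fun_add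
    (((hasDerivAt_th z).fun_mul (hasDerivAt_stInt_apply f z)).const_mul 3)
  refine h.congr_deriv ?_
  rw [invG_apply, sc_eq]
  ring

/-! ### Branches of solutions of weakly nonlinear perturbations -/

/-- Triples `(u, u', u'')` of bounded continuous functions. -/
abbrev Jet := BC × BC × BC

/-- The second and third components are the first and second derivative of the first. -/
structure IsJet (X : Jet) : Prop where
  deriv₁ : ∀ z, HasDerivAt X.1 (X.2.1 z) z
  deriv₂ : ∀ z, HasDerivAt X.2.1 (X.2.2 z) z

theorem IsJet.add_smul {X Y : Jet} (hX : IsJet X) (hY : IsJet Y) (c : ℝ) : IsJet (X + c • Y) :=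
  ⟨fun z => (hX.deriv₁ z).add ((hY.deriv₁ z).const_mul c),
    fun z => (hX.deriv₂ z).add ((hY.deriv₂ z).const_mul c)⟩

theorem Jet.norm_fst_le (X : Jet) : ‖X.1‖ ≤ ‖X‖ := _root_.norm_fst_le X

theorem Jet.norm_snd_le (X : Jet) : ‖X.2.1‖ ≤ ‖X‖ :=
  (_root_.norm_fst_le X.2).trans (_root_.norm_snd_le X)

theorem Jet.norm_trd_le (X : Jet) : ‖X.2.2‖ ≤ ‖X‖ :=
  (_root_.norm_snd_le X.2).trans (_root_.norm_snd_le X)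

/-- The implicit function theorem with a uniqueness radius independent of `ε`; uniqueness is used
for periodicity. -/
theorem exists_zero_branch {E : Type*} [NormedAddCommGroup E] [NormedSpace ℝ E] [CompleteSpace E]
    {F : ℝ × E → E} (hF : ContDiff ℝ 1 F) {x₀ : E} (h0 : F (0, x₀) = 0) (D : E ≃L[ℝ] E)
    (hD : HasFDerivAt (fun x => F (0, x)) (D : E →L[ℝ] E) x₀) :
    ∃ ε₀ > 0, ∃ ρ > 0, ∀ ε : ℝ, |ε| < ε₀ → ∃ x : E, F (ε, x) = 0 ∧ ‖x - x₀‖ < ρ ∧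
      ∀ y, ‖y - x₀‖ < ρ → F (ε, y) = 0 → y = x := by
  have hs : HasStrictFDerivAt F (fderiv ℝ F (0, x₀)) (0, x₀) :=
    hF.contDiffAt.hasStrictFDerivAt one_ne_zero
  have hinv : (fderiv ℝ F (0, x₀) ∘L .inr ℝ ℝ E) = D := by
    refine HasFDerivAt.unique ?_ hD
    exact hs.hasFDerivAt.comp x₀ (hasFDerivAt_prodMk_right 0 x₀)
  have hI : (fderiv ℝ F (0, x₀) ∘L .inr ℝ ℝ E).IsInvertible := ⟨D, hinv.symm⟩
  have h1 := hs.eventually_apply_eq_iff_implicitFunctionOfProdDomain hI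
  have h2 := hs.tendsto_implicitFunctionOfProdDomain hI
  set ψ := hs.implicitFunctionOfProdDomain hI
  rw [h0] at h1
  obtain ⟨δ, hδ, hb⟩ := Metric.eventually_nhds_iff.1 h1
  obtain ⟨δ', hδ', hb'⟩ := Metric.eventually_nhds_iff.1 (h2.eventually (Metric.ball_mem_nhds x₀ hδ))
  refine ⟨min δ δ', lt_min hδ hδ', δ, hδ, fun ε hε => ?_⟩
  have key : ∀ y, ‖y - x₀‖ < δ → (F (ε, y) = 0 ↔ ψ ε = y) := fun y hy =>
    hb (y := (ε, y)) (by
      rw [Prod.dist_eq, dist_eq_norm y]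
      exact max_lt (by simpa using hε.trans_le (min_le_left _ _)) hy)
  have hψ : ‖ψ ε - x₀‖ < δ := by
    rw [← dist_eq_norm]
    exact hb' (by simpa using hε.trans_le (min_le_right _ _))
  exact ⟨ψ ε, (key _ hψ).2 rfl, hψ, fun y hy h => ((key y hy).1 h).symm⟩

/-! ### The periodic branch at the equilibrium -/

/-- Translation of jets. -/
def shiftJet (b : ℝ) (X : Jet) : Jet := (shift b X.1, shift b X.2.1, shift b X.2.2)

/-- The jet of the bounded solution of `u'' - u = f`. -/
def jetK : BC →L[ℝ] Jet := invK.prod (invK'.prod (ContinuousLinearMap.id ℝ BC + invK))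

theorem isJet_jetK (f : BC) : IsJet (jetK f) :=
  ⟨hasDerivAt_invK f, fun z => (hasDerivAt_invK' f z).congr_deriv (add_comm _ _)⟩

theorem jetK_shift (b : ℝ) (f : BC) : jetK (shift b f) = shiftJet b (jetK f) := by
  simp [jetK, shiftJet, invK_shift, invK'_shift]

theorem exists_periodic_branch {R : Jet × Jet → BC × BC} (hR : ContDiff ℝ 1 R) (T : ℝ)
    (hRT : ∀ X, R (shiftJet T X.1, shiftJet T X.2) = (shift T (R X).1, shift T (R X).2))
    (N : BC × BC) (hN₁ : shift T N.1 = N.1) (hN₂ : shift T N.2 = N.2) :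
    ∃ ε₀ > 0, ∃ C : ℝ, ∀ ε : ℝ, |ε| < ε₀ → ∃ X Y : Jet, IsJet X ∧ IsJet Y ∧ ‖X‖ ≤ C ∧ ‖Y‖ ≤ C ∧
      (∀ z, X.2.2 z - X.1 z = N.1 z + ε * (R (X, Y)).1 z) ∧
      (∀ z, Y.2.2 z - Y.1 z = N.2 z + ε * (R (X, Y)).2 z) ∧
      shiftJet T X = X ∧ shiftJet T Y = Y := by
  let J : BC × BC →L[ℝ] Jet × Jet := jetK.prodMap jetK
  -- The unknown is the right-hand side `f` rather than the solution, so at `ε = 0` the map is a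
  -- translation of the identity.
  let F : ℝ × (BC × BC) → BC × BC := fun v => v.2 - N - v.1 • R (J v.2)
  have hF : ContDiff ℝ 1 F := by
    have : ContDiff ℝ 1 fun v : ℝ × (BC × BC) => R (J v.2) :=
      hR.comp (J.contDiff.comp contDiff_snd)
    exact (contDiff_snd.sub contDiff_const).sub (contDiff_fst.smul this)
  obtain ⟨ε₀, hε₀, ρ, hρ, hb⟩ := exists_zero_branch hF (x₀ := N) (by simp [F])
    (ContinuousLinearEquiv.refl ℝ _) (by
      have : (fun x => F (0, x)) = fun x => x - N := by funext x; simp [F]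
      rw [this]
      exact (hasFDerivAt_id N).sub_const N)
  refine ⟨ε₀, hε₀, ‖jetK‖ * (‖N‖ + ρ), fun ε hε => ?_⟩
  obtain ⟨f, hf, hfn, hu⟩ := hb ε hε
  have hfn' : ‖f‖ ≤ ‖N‖ + ρ := by
    have := norm_add_le N (f - N)
    rw [add_sub_cancel] at this
    linarith
  -- The translate by `T` is another zero in the same ball, as translation does not increase the
  -- norm and fixes `N`.
  have hT : (shift T f.1, shift T f.2) = f := by
    refine hu _ ?_ ?_
    · have : (shift T f.1, shift T f.2) - N = (shift T (f - N).1, shift T (f - N).2) := by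
        ext1 <;> simp [hN₁, hN₂]
      rw [this]
      refine lt_of_le_of_lt ?_ hfn
      exact max_le ((norm_shift_le T _).trans (norm_fst_le _))
        ((norm_shift_le T _).trans (norm_snd_le _))
    · have e : J (shift T f.1, shift T f.2) = (shiftJet T (J f).1, shiftJet T (J f).2) := by
        simp [J, jetK_shift]
      have h1 := congrArg (fun v => (shift T v.1, shift T v.2)) hf
      simp only [F, e, hRT] at h1 ⊢
      refine Eq.trans ?_ (h1.trans ?_)
      · ext1 <;> simp [hN₁, hN₂]
      · simp
  have hT₁ : shift T f.1 = f.1 := congrArg Prod.fst hT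
  have hT₂ : shift T f.2 = f.2 := congrArg Prod.snd hT
  have e : f = N + ε • R (jetK f.1, jetK f.2) := by
    have : f - N - ε • R (jetK f.1, jetK f.2) = 0 := hf
    rw [sub_sub, sub_eq_zero] at this
    exact this
  have e₁ : f.1 = N.1 + ε • (R (jetK f.1, jetK f.2)).1 := congrArg Prod.fst e
  have e₂ : f.2 = N.2 + ε • (R (jetK f.1, jetK f.2)).2 := congrArg Prod.snd e
  refine ⟨jetK f.1, jetK f.2, isJet_jetK _, isJet_jetK _, ?_, ?_, fun z => ?_, fun z => ?_, ?_, ?_⟩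
  · exact (jetK.le_opNorm _).trans (mul_le_mul_of_nonneg_left
      ((norm_fst_le f).trans hfn') (norm_nonneg _))
  · exact (jetK.le_opNorm _).trans (mul_le_mul_of_nonneg_left
      ((norm_snd_le f).trans hfn') (norm_nonneg _))
  · have := DFunLike.congr_fun e₁ z
    simp only [BoundedContinuousFunction.coe_add, Pi.add_apply,
      BoundedContinuousFunction.coe_smul, smul_eq_mul] at this
    rw [← this]
    simp [jetK]
  · have := DFunLike.congr_fun e₂ z
    simp only [BoundedContinuousFunction.coe_add, Pi.add_apply,
      BoundedContinuousFunction.coe_smul, smul_eq_mul] at this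
    rw [← this]
    simp [jetK]
  · rw [← jetK_shift, hT₁]
  · rw [← jetK_shift, hT₂]

/-! ### The homoclinic branch by Lyapunov–Schmidt reduction -/

/-- The jet of the kernel function `sech² tanh`. -/
def jetST : Jet := (scB * thB, (1 / 2 : ℝ) • (scB * scB) - scB * thB * thB,
  scB * thB - (3 : ℝ) • (scB * (scB * thB)))

theorem isJet_jetST : IsJet jetST := by
  constructor
  · intro z
    refine ((hasDerivAt_sc z).mul (hasDerivAt_th z)).congr_deriv ?_
    simp [jetST]; ring
  · intro z
    have h := (((hasDerivAt_sc z).mul (hasDerivAt_sc z)).const_mul (1 / 2 : ℝ)).sub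
      (((hasDerivAt_sc z).mul (hasDerivAt_th z)).mul (hasDerivAt_th z))
    refine h.congr_deriv ?_
    simp [jetST]
    rw [sc_eq]; ring

/-- The jet of the solution of `u'' - u + 3 sech² (z / 2) u = f` given by `invG`. -/
def jetG : BC →L[ℝ] Jet :=
  invG.prod (invG'.prod (projS + (invG - (3 : ℝ) • (mulOp scB ∘L invG))))

theorem isJet_jetG (f : BC) : IsJet (jetG f) :=
  ⟨hasDerivAt_invG f, fun z => (hasDerivAt_invG' f z).congr_deriv (by
    simp [jetG]; ring)⟩

/-- The operator `u'' - u + 3 sech² (z / 2) u` on jets. -/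
def linOp (X : Jet) (z : ℝ) : ℝ := X.2.2 z - X.1 z + 3 * sc z * X.1 z

theorem linOp_jetG (f : BC) (z : ℝ) : linOp (jetG f) z = projS f z := by
  simp [linOp, jetG]; ring

theorem linOp_jetST (z : ℝ) : linOp jetST z = 0 := by
  simp [linOp, jetST]; ring

theorem linOp_add_smul (X Y : Jet) (c : ℝ) (z : ℝ) :
    linOp (X + c • Y) z = linOp X z + c * linOp Y z := by
  simp [linOp]; ring

/-- Right-hand sides together with amplitudes of the kernel functions. -/
abbrev BranchSpace := (BC × BC) × (ℝ × ℝ)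

theorem exists_homoclinic_branch {R : Jet × Jet → BC × BC} (hR : ContDiff ℝ 1 R)
    (N : BC × BC) (hN₁ : solv N.1 = 0) (hN₂ : solv N.2 = 0) (κ : ℝ)
    (A : (ℝ × ℝ) ≃L[ℝ] (ℝ × ℝ))
    (hA : ∀ X Y : Jet, IsJet X → IsJet Y → (∀ z, linOp X z = N.1 z) → (∀ z, linOp Y z = N.2 z) →
      ∀ α : ℝ × ℝ, (solv (R (X + α.1 • κ • jetST, Y + α.2 • κ • jetST)).1,
        solv (R (X + α.1 • κ • jetST, Y + α.2 • κ • jetST)).2) =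
        (solv (R (X, Y)).1, solv (R (X, Y)).2) + A α) :
    ∃ ε₀ > 0, ∃ C : ℝ, ∀ ε : ℝ, |ε| < ε₀ → ∃ X Y : Jet, IsJet X ∧ IsJet Y ∧ ‖X‖ ≤ C ∧ ‖Y‖ ≤ C ∧
      (∀ z, linOp X z = N.1 z + ε * (R (X, Y)).1 z) ∧
      (∀ z, linOp Y z = N.2 z + ε * (R (X, Y)).2 z) := by
  let J : BranchSpace →L[ℝ] Jet × Jet := (jetG.prodMap jetG) ∘L .fst ℝ _ _ +
    (((ContinuousLinearMap.fst ℝ ℝ ℝ).smulRight (κ • jetST)).prod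
      ((ContinuousLinearMap.snd ℝ ℝ ℝ).smulRight (κ • jetST))) ∘L .snd ℝ _ _
  have hJ : ∀ f α, J (f, α) = (jetG f.1 + α.1 • κ • jetST, jetG f.2 + α.2 • κ • jetST) :=
    fun f α => rfl
  let S : BC × BC →L[ℝ] ℝ × ℝ := solv.prodMap solv
  -- No projection is needed in the first component: once `S (R …) = 0`, the equation `f = N + εR`
  -- makes `f` itself solvable, so `projS f = f`. Imposing `S R = 0` rather than `ε S R = 0` keeps
  -- the system nondegenerate at `ε = 0`.
  let F : ℝ × BranchSpace → BranchSpace := fun v => (v.2.1 - N - v.1 • R (J v.2), S (R (J v.2)))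
  have hRJ : ContDiff ℝ 1 fun x : BranchSpace => R (J x) := hR.comp J.contDiff
  have hSR : ContDiff ℝ 1 fun x : BranchSpace => S (R (J x)) := S.contDiff.comp hRJ
  have hF : ContDiff ℝ 1 F := by
    refine ContDiff.prodMk ?_ (hSR.comp contDiff_snd)
    exact ((contDiff_fst.comp contDiff_snd).sub contDiff_const).sub
      (contDiff_fst.smul (hRJ.comp contDiff_snd))
  have hL₁ : ∀ z, linOp (jetG N.1) z = N.1 z := fun z => by
    rw [linOp_jetG, projS_of_solv hN₁]
  have hL₂ : ∀ z, linOp (jetG N.2) z = N.2 z := fun z => by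
    rw [linOp_jetG, projS_of_solv hN₂]
  have hAff : ∀ α, S (R (J (N, α))) = S (R (jetG N.1, jetG N.2)) + A α := fun α =>
    hA _ _ (isJet_jetG _) (isJet_jetG _) hL₁ hL₂ α
  let α₀ : ℝ × ℝ := A.symm (-S (R (jetG N.1, jetG N.2)))
  have hα₀ : S (R (J (N, α₀))) = 0 := by rw [hAff]; simp [α₀]
  have hd : HasFDerivAt (fun x : BranchSpace => S (R (J x))) (fderiv ℝ (fun x : BranchSpace => S (R (J x))) (N, α₀))
      (N, α₀) := (hSR.differentiable one_ne_zero _).hasFDerivAt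
  set D := fderiv ℝ (fun x : BranchSpace => S (R (J x))) (N, α₀) with hDdef
  have hDA : D ∘L .inr ℝ (BC × BC) (ℝ × ℝ) = A := by
    refine HasFDerivAt.unique (f := fun α => S (R (J (N, α)))) (x := α₀) ?_ ?_
    · exact hd.comp α₀ (hasFDerivAt_prodMk_right N α₀)
    · have : (fun α => S (R (J (N, α)))) = fun α => S (R (jetG N.1, jetG N.2)) + A α :=
        funext hAff
      rw [this]
      exact A.hasFDerivAt.const_add _
  have hDapp : ∀ f α, D (f, α) = D (f, 0) + A α := fun f α => by
    rw [← ContinuousLinearEquiv.coe_coe, ← hDA]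
    rw [ContinuousLinearMap.comp_apply, ← map_add]
    simp
  -- The derivative at `ε = 0` is block triangular with diagonal blocks the identity and `A`, and is
  -- inverted by back substitution.
  let De : BranchSpace ≃L[ℝ] BranchSpace := ContinuousLinearEquiv.equivOfInverse
    ((ContinuousLinearMap.fst ℝ _ _).prod D)
    ((ContinuousLinearMap.fst ℝ _ _).prod ((A.symm : (ℝ × ℝ) →L[ℝ] (ℝ × ℝ)) ∘L
      (ContinuousLinearMap.snd ℝ _ _ -
        (D ∘L .inl ℝ (BC × BC) (ℝ × ℝ)) ∘L ContinuousLinearMap.fst ℝ _ _)))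
    (fun x => by
      obtain ⟨f, α⟩ := x
      change (f, A.symm (D (f, α) - D (f, 0))) = (f, α)
      rw [hDapp f α]; simp)
    (fun x => by
      obtain ⟨f, α⟩ := x
      change (f, D (f, A.symm (α - D (f, 0)))) = (f, α)
      rw [hDapp f]; simp)
  obtain ⟨ε₀, hε₀, ρ, hρ, hb⟩ := exists_zero_branch hF (x₀ := (N, α₀))
    (by simp only [F, hα₀, sub_self, zero_smul]; rfl) De (by
      have : (fun x => F (0, x)) = fun x => (x.1 - N, S (R (J x))) := by funext x; simp [F]
      rw [this]
      exact (hasFDerivAt_fst.sub_const N).prodMk hd)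
  refine ⟨ε₀, hε₀, ‖J‖ * (‖((N, α₀) : BranchSpace)‖ + ρ), fun ε hε => ?_⟩
  obtain ⟨⟨f, α⟩, hf, hfn, -⟩ := hb ε hε
  have hfn' : ‖((f, α) : BranchSpace)‖ ≤ ‖((N, α₀) : BranchSpace)‖ + ρ := by
    have := norm_add_le ((N, α₀) : BranchSpace) ((f, α) - (N, α₀))
    rw [add_sub_cancel] at this
    linarith
  have hnJ : ‖J (f, α)‖ ≤ ‖J‖ * (‖((N, α₀) : BranchSpace)‖ + ρ) :=
    (J.le_opNorm _).trans (mul_le_mul_of_nonneg_left hfn' (norm_nonneg _))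
  have e : f = N + ε • R (J (f, α)) := by
    have : f - N - ε • R (J (f, α)) = 0 := congrArg Prod.fst hf
    rw [sub_sub, sub_eq_zero] at this
    exact this
  have hS : S (R (J (f, α))) = 0 := congrArg Prod.snd hf
  have hS₁ : solv (R (J (f, α))).1 = 0 := congrArg Prod.fst hS
  have hS₂ : solv (R (J (f, α))).2 = 0 := congrArg Prod.snd hS
  have e₁ : f.1 = N.1 + ε • (R (J (f, α))).1 := congrArg Prod.fst e
  have e₂ : f.2 = N.2 + ε • (R (J (f, α))).2 := congrArg Prod.snd e
  have s₁ : solv f.1 = 0 := by rw [e₁]; simp [hN₁, hS₁]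
  have s₂ : solv f.2 = 0 := by rw [e₂]; simp [hN₂, hS₂]
  have hj : IsJet (κ • jetST) := by
    have := (isJet_jetK 0).add_smul isJet_jetST κ
    simpa using this
  have hl : ∀ z, linOp (κ • jetST) z = 0 := fun z => by
    have := linOp_add_smul 0 jetST κ z
    rw [zero_add, linOp_jetST] at this
    simpa [linOp] using this
  refine ⟨(J (f, α)).1, (J (f, α)).2, ?_, ?_, (norm_fst_le _).trans hnJ, (norm_snd_le _).trans hnJ,
    fun z => ?_, fun z => ?_⟩
  · exact (isJet_jetG _).add_smul hj _
  · exact (isJet_jetG _).add_smul hj _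
  · have := DFunLike.congr_fun e₁ z
    rw [show (J (f, α)).1 = jetG f.1 + α.1 • κ • jetST from rfl, linOp_add_smul, hl, linOp_jetG,
      projS_of_solv s₁, this]
    simp [hJ]
  · have := DFunLike.congr_fun e₂ z
    rw [show (J (f, α)).2 = jetG f.2 + α.2 • κ • jetST from rfl, linOp_add_smul, hl, linOp_jetG,
      projS_of_solv s₂, this]
    simp [hJ]

/-! ### Decay at infinity -/

/-- `e^z (b - m)` is eventually nonincreasing; the second `m` absorbs the decaying initial value. -/
theorem eventually_le_of_stable {b w : ℝ → ℝ} (hb : ∀ z, HasDerivAt b (w z - b z) z) {m : ℝ}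
    (hm : 0 < m) (hw : ∀ᶠ z in atTop, w z ≤ m) : ∀ᶠ z in atTop, b z ≤ 2 * m := by
  obtain ⟨Z, hZ⟩ := eventually_atTop.1 hw
  have hd : ∀ z, HasDerivAt (fun z => Real.exp z * (b z - m)) (Real.exp z * (w z - m)) z :=
    fun z => ((Real.hasDerivAt_exp z).fun_mul ((hb z).sub_const m)).congr_deriv (by ring)
  have hanti : AntitoneOn (fun z => Real.exp z * (b z - m)) (Ici Z) := by
    refine antitoneOn_of_deriv_nonpos (convex_Ici Z)
      (fun z _ => (hd z).continuousAt.continuousWithinAt)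
      (fun z _ => (hd z).differentiableAt.differentiableWithinAt) fun z hz => ?_
    rw [interior_Ici] at hz
    rw [(hd z).deriv]
    exact mul_nonpos_of_nonneg_of_nonpos (Real.exp_pos z).le (sub_nonpos.2 (hZ z hz.le))
  have ht : Tendsto (fun z => Real.exp (-z) * (Real.exp Z * (b Z - m))) atTop (𝓝 0) := by
    simpa using (Real.tendsto_exp_neg_atTop_nhds_zero).mul_const (Real.exp Z * (b Z - m))
  filter_upwards [ht.eventually (gt_mem_nhds hm), eventually_ge_atTop Z] with z h1 h2
  have h3 := hanti self_mem_Ici h2 h2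
  simp only at h3
  have h4 := mul_le_mul_of_nonneg_left h3 (Real.exp_pos (-z)).le
  rw [← mul_assoc, ← Real.exp_add, neg_add_cancel, Real.exp_zero, one_mul] at h4
  linarith

/-- `e^{-z} (a + m)` is nonincreasing and, `a` being bounded, tends to zero, so it is nonnegative.
Boundedness excludes the growing mode and costs no constant. -/
theorem neg_le_of_unstable {a w : ℝ → ℝ} (ha : ∀ z, HasDerivAt a (a z + w z) z) {m B : ℝ}
    (hB : ∀ z, |a z| ≤ B) {Z : ℝ} (hw : ∀ z ≥ Z, w z ≤ m) (z : ℝ) (hz : Z ≤ z) : -m ≤ a z := by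
  have hd : ∀ z, HasDerivAt (fun z => Real.exp (-z) * (a z + m)) (Real.exp (-z) * (w z - m)) z :=
    fun z => ((hasDerivAt_neg z).exp.fun_mul ((ha z).add_const m)).congr_deriv (by ring)
  have hanti : AntitoneOn (fun z => Real.exp (-z) * (a z + m)) (Ici Z) := by
    refine antitoneOn_of_deriv_nonpos (convex_Ici Z)
      (fun z _ => (hd z).continuousAt.continuousWithinAt)
      (fun z _ => (hd z).differentiableAt.differentiableWithinAt) fun z hz => ?_
    rw [interior_Ici] at hz
    rw [(hd z).deriv]
    exact mul_nonpos_of_nonneg_of_nonpos (Real.exp_pos _).le (sub_nonpos.2 (hw z hz.le))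
  have ht : Tendsto (fun z => Real.exp (-z) * (a z + m)) atTop (𝓝 0) := by
    refine squeeze_zero_norm (a := fun z => Real.exp (-z) * (B + |m|)) (fun z => ?_) ?_
    · rw [norm_mul, Real.norm_eq_abs, Real.norm_eq_abs, abs_of_pos (Real.exp_pos _)]
      exact mul_le_mul_of_nonneg_left ((abs_add_le _ _).trans (add_le_add_left (hB z) _))
        (Real.exp_pos _).le
    · simpa using (Real.tendsto_exp_neg_atTop_nhds_zero).mul_const (B + |m|)
  have h0 : 0 ≤ Real.exp (-z) * (a z + m) := by
    refine le_of_tendsto ht ?_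
    filter_upwards [eventually_ge_atTop z] with y hy
    exact hanti hz (hz.trans hy) hy
  have := nonneg_of_mul_nonneg_right h0 (Real.exp_pos _)
  linarith

/-- `u'' - u = w` splits into the stable variable `u' - u`, eventually at most `2m` in modulus, and
the unstable `u' + u`, at most `m`. Hence `|u|, |u'| ≤ 3m/2` and `|u''| ≤ 5m/2`, within the stated
`4m`. -/
theorem IsJet.eventually_abs_le {D : Jet} (hD : IsJet D) {m : ℝ} (hm : 0 < m)
    (hw : ∀ᶠ z in atTop, |D.2.2 z - D.1 z| ≤ m) :
    ∀ᶠ z in atTop, |D.1 z| ≤ 4 * m ∧ |D.2.1 z| ≤ 4 * m ∧ |D.2.2 z| ≤ 4 * m := by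
  have h1 := eventually_le_of_stable (b := fun z => D.2.1 z - D.1 z)
    (w := fun z => D.2.2 z - D.1 z)
    (fun z => ((hD.deriv₂ z).fun_sub (hD.deriv₁ z)).congr_deriv (by ring)) hm
    (hw.mono fun z h => (abs_le.1 h).2)
  have h2 := eventually_le_of_stable (b := fun z => -(D.2.1 z - D.1 z))
    (w := fun z => -(D.2.2 z - D.1 z))
    (fun z => ((hD.deriv₂ z).fun_sub (hD.deriv₁ z)).fun_neg.congr_deriv (by ring)) hm
    (hw.mono fun z h => by linarith [(abs_le.1 h).1])
  obtain ⟨Z, hZ⟩ := eventually_atTop.1 hw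
  have hB : ∀ z, |D.2.1 z + D.1 z| ≤ ‖D.2.1‖ + ‖D.1‖ := fun z =>
    (abs_add_le _ _).trans (add_le_add (BC.abs_le _ z) (BC.abs_le _ z))
  have h3 := neg_le_of_unstable (a := fun z => D.2.1 z + D.1 z)
    (w := fun z => D.2.2 z - D.1 z)
    (fun z => ((hD.deriv₂ z).fun_add (hD.deriv₁ z)).congr_deriv (by ring)) hB
    (fun z hz => (abs_le.1 (hZ z hz)).2)
  have h4 := neg_le_of_unstable (m := m) (a := fun z => -(D.2.1 z + D.1 z))
    (w := fun z => -(D.2.2 z - D.1 z))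
    (fun z => ((hD.deriv₂ z).fun_add (hD.deriv₁ z)).fun_neg.congr_deriv (by ring))
    (fun z => by rw [abs_neg]; exact hB z)
    (fun z hz => by linarith [(abs_le.1 (hZ z hz)).1])
  filter_upwards [h1, h2, eventually_ge_atTop Z] with z h1 h2 hz
  have h3 := h3 z hz
  have h4 := h4 z hz
  have h5 := abs_le.1 (hZ z hz)
  refine ⟨abs_le.2 ⟨?_, ?_⟩, abs_le.2 ⟨?_, ?_⟩, abs_le.2 ⟨?_, ?_⟩⟩ <;> linarith

/-- Eventual bounds are insensitive to finite shifts of the argument, so this iteration handles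
advances and delays where a Gronwall argument would not apply directly. -/
theorem tendsto_zero_atTop_of_halving {ι : Type*} {F : ι → ℝ → ℝ} {B : ℝ} (hB : 0 < B)
    (h0 : ∀ᶠ z in atTop, ∀ i, |F i z| ≤ B)
    (h : ∀ m > 0, (∀ᶠ z in atTop, ∀ i, |F i z| ≤ m) → ∀ᶠ z in atTop, ∀ i, |F i z| ≤ m / 2)
    (i : ι) : Tendsto (F i) atTop (𝓝 0) := by
  have hn : ∀ n : ℕ, ∀ᶠ z in atTop, ∀ i, |F i z| ≤ B * (1 / 2) ^ n := by
    intro n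
    induction n with
    | zero => simpa using h0
    | succ n ih =>
      refine (h _ (by positivity) ih).mono fun z hz i => (hz i).trans (le_of_eq ?_)
      rw [pow_succ]; ring
  rw [Metric.tendsto_nhds]
  intro δ hδ
  have ht : Tendsto (fun n : ℕ => B * (1 / 2 : ℝ) ^ n) atTop (𝓝 0) := by
    simpa using (tendsto_pow_atTop_nhds_zero_of_lt_one (r := (1 / 2 : ℝ)) (by norm_num)
      (by norm_num)).const_mul B
  obtain ⟨n, hlt⟩ := (ht.eventually (gt_mem_nhds hδ)).exists
  filter_upwards [hn n] with z hz
  rw [Real.dist_eq, sub_zero]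
  exact (hz i).trans_lt hlt

/-- A differential inequality with advances and delays and small coefficients for a jet `D`
coupled to a jet `E`. -/
def SmallCoupling (κ : ℝ → ℝ) (e b η : ℝ) (D E : Jet) : Prop :=
  ∀ z, |D.2.2 z - D.1 z| ≤ κ z * |D.1 z| +
    e * (|E.2.2 (z + b)| + |E.2.2 (z + η)| + |E.1 (z + b)| + |E.1 (z + η)| + |D.2.1 z|)

/-- The right-hand side is eventually at most `m/16 + 5m/80 = m/8`, and `IsJet.eventually_abs_le`
multiplies this by 4. -/
theorem SmallCoupling.eventually {κ : ℝ → ℝ} {e b η : ℝ} {D E : Jet}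
    (h : SmallCoupling κ e b η D E) (hD : IsJet D) (hκ : ∀ᶠ z in atTop, κ z ≤ 1 / 16) (he : e ≤ 1 / 80) {m : ℝ} (hm : 0 < m)
    (h₁ : ∀ᶠ z in atTop, |D.1 z| ≤ m ∧ |D.2.1 z| ≤ m ∧ |D.2.2 z| ≤ m)
    (h₂ : ∀ᶠ z in atTop, |E.1 z| ≤ m ∧ |E.2.1 z| ≤ m ∧ |E.2.2 z| ≤ m) :
    ∀ᶠ z in atTop, |D.1 z| ≤ m / 2 ∧ |D.2.1 z| ≤ m / 2 ∧ |D.2.2 z| ≤ m / 2 := by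
  have hb := (tendsto_atTop_add_const_right atTop b tendsto_id).eventually h₂
  have hη := (tendsto_atTop_add_const_right atTop η tendsto_id).eventually h₂
  refine (hD.eventually_abs_le (m := m / 8) (by positivity) ?_).mono fun z hz => by
    refine ⟨?_, ?_, ?_⟩ <;> linarith [hz.1, hz.2.1, hz.2.2]
  filter_upwards [hκ, h₁, hb, hη] with z hκ h₁ hb hη
  simp only [id] at hb hη
  refine (h z).trans ?_
  have a1 : κ z * |D.1 z| ≤ 1 / 16 * m :=
    (mul_le_mul_of_nonneg_right hκ (abs_nonneg _)).trans
      (mul_le_mul_of_nonneg_left h₁.1 (by norm_num))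
  have a2 : e * (|E.2.2 (z + b)| + |E.2.2 (z + η)| + |E.1 (z + b)| + |E.1 (z + η)| + |D.2.1 z|)
      ≤ 1 / 80 * (5 * m) :=
    mul_le_mul he (by linarith [hb.1, hb.2.2, hη.1, hη.2.2, h₁.2.1]) (by positivity)
      (by norm_num)
  linarith

theorem tendsto_zero_of_smallCoupling {κ₁ κ₂ : ℝ → ℝ} {e b₁ η₁ b₂ η₂ : ℝ} {D E : Jet}
    (hD : IsJet D) (hE : IsJet E) (h₁ : SmallCoupling κ₁ e b₁ η₁ D E)
    (h₂ : SmallCoupling κ₂ e b₂ η₂ E D) (hκ₁ : ∀ᶠ z in atTop, κ₁ z ≤ 1 / 16)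
    (hκ₂ : ∀ᶠ z in atTop, κ₂ z ≤ 1 / 16) (he : e ≤ 1 / 80) :
    (Tendsto D.1 atTop (𝓝 0) ∧ Tendsto D.2.1 atTop (𝓝 0)) ∧
      (Tendsto E.1 atTop (𝓝 0) ∧ Tendsto E.2.1 atTop (𝓝 0)) := by
  let F : Fin 6 → ℝ → ℝ := ![D.1, D.2.1, D.2.2, E.1, E.2.1, E.2.2]
  have hF : ∀ m z, (∀ i, |F i z| ≤ m) ↔ (|D.1 z| ≤ m ∧ |D.2.1 z| ≤ m ∧ |D.2.2 z| ≤ m) ∧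
      (|E.1 z| ≤ m ∧ |E.2.1 z| ≤ m ∧ |E.2.2 z| ≤ m) := by
    intro m z
    simp [F, Fin.forall_fin_succ]
    tauto
  have hB : ∀ᶠ z in atTop, ∀ i, |F i z| ≤ ‖D‖ + ‖E‖ + 1 := by
    refine Eventually.of_forall fun z => (hF _ _).2 ?_
    have := norm_nonneg D
    have := norm_nonneg E
    refine ⟨⟨?_, ?_, ?_⟩, ?_, ?_, ?_⟩
    · linarith [BC.abs_le D.1 z, Jet.norm_fst_le D]
    · linarith [BC.abs_le D.2.1 z, Jet.norm_snd_le D]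
    · linarith [BC.abs_le D.2.2 z, Jet.norm_trd_le D]
    · linarith [BC.abs_le E.1 z, Jet.norm_fst_le E]
    · linarith [BC.abs_le E.2.1 z, Jet.norm_snd_le E]
    · linarith [BC.abs_le E.2.2 z, Jet.norm_trd_le E]
  have key := tendsto_zero_atTop_of_halving (F := F) (by positivity) hB fun m hm h => by
    simp only [hF, eventually_and] at h ⊢
    simp only [← eventually_and] at h ⊢
    have h1 := h₁.eventually hD hκ₁ he hm (h.mono fun z hz => ⟨hz.1.1, hz.1.2.1, hz.1.2.2⟩)
      (h.mono fun z hz => ⟨hz.2.1, hz.2.2.1, hz.2.2.2⟩)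
    have h2 := h₂.eventually hE hκ₂ he hm (h.mono fun z hz => ⟨hz.2.1, hz.2.2.1, hz.2.2.2⟩)
      (h.mono fun z hz => ⟨hz.1.1, hz.1.2.1, hz.1.2.2⟩)
    exact h1.and h2
  exact ⟨⟨key 0, key 1⟩, key 3, key 4⟩

/-- The reflected jet. -/
def reflJet (D : Jet) : Jet := (refl' D.1, -refl' D.2.1, refl' D.2.2)

theorem IsJet.refl {D : Jet} (hD : IsJet D) : IsJet (reflJet D) := by
  constructor
  · intro z
    exact ((hD.deriv₁ (-z)).comp z (hasDerivAt_neg z)).congr_deriv (by simp [reflJet])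
  · intro z
    exact ((hD.deriv₂ (-z)).comp z (hasDerivAt_neg z)).fun_neg.congr_deriv (by simp [reflJet])

theorem SmallCoupling.refl {κ : ℝ → ℝ} {e b η : ℝ} {D E : Jet} (h : SmallCoupling κ e b η D E) :
    SmallCoupling (fun z => κ (-z)) e (-b) (-η) (reflJet D) (reflJet E) := by
  intro z
  have := h (-z)
  simpa [reflJet, add_comm] using this

theorem tendsto_zero_of_smallCoupling_atBot {κ₁ κ₂ : ℝ → ℝ} {e b₁ η₁ b₂ η₂ : ℝ} {D E : Jet}
    (hD : IsJet D) (hE : IsJet E) (h₁ : SmallCoupling κ₁ e b₁ η₁ D E)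
    (h₂ : SmallCoupling κ₂ e b₂ η₂ E D) (hκ₁ : ∀ᶠ z in atBot, κ₁ z ≤ 1 / 16)
    (hκ₂ : ∀ᶠ z in atBot, κ₂ z ≤ 1 / 16) (he : e ≤ 1 / 80) :
    (Tendsto D.1 atBot (𝓝 0) ∧ Tendsto D.2.1 atBot (𝓝 0)) ∧
      (Tendsto E.1 atBot (𝓝 0) ∧ Tendsto E.2.1 atBot (𝓝 0)) := by
  have h := tendsto_zero_of_smallCoupling hD.refl hE.refl h₁.refl h₂.refl
    (tendsto_neg_atTop_atBot.eventually hκ₁) (tendsto_neg_atTop_atBot.eventually hκ₂) he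
  have back : ∀ f : BC, Tendsto (refl' f) atTop (𝓝 0) → Tendsto f atBot (𝓝 0) := fun f hf => by
    have := hf.comp tendsto_neg_atBot_atTop
    exact this.congr fun z => by simp
  have back' : ∀ f : BC, Tendsto (-refl' f) atTop (𝓝 0) → Tendsto f atBot (𝓝 0) := fun f hf => by
    have := (hf.comp tendsto_neg_atBot_atTop).neg
    rw [neg_zero] at this
    exact this.congr fun z => by simp
  exact ⟨⟨back _ h.1.1, back' _ h.1.2⟩, back _ h.2.1, back' _ h.2.2⟩

/-! ### The advance-delay system in the space of jets -/

theorem IsJet.deriv_fst {X : Jet} (hX : IsJet X) : deriv X.1 = X.2.1 :=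
  funext fun z => (hX.deriv₁ z).deriv

theorem IsJet.deriv_snd {X : Jet} (hX : IsJet X) : deriv X.2.1 = X.2.2 :=
  funext fun z => (hX.deriv₂ z).deriv

theorem IsJet.contDiff {X : Jet} (hX : IsJet X) : ContDiff ℝ 2 X.1 := by
  have h1 : ContDiff ℝ 1 X.2.1 := contDiff_one_iff_deriv.2
    ⟨fun z => (hX.deriv₂ z).differentiableAt, by rw [hX.deriv_snd]; exact X.2.2.continuous⟩
  have : (2 : WithTop ℕ∞) = 1 + 1 := by norm_num
  rw [this, contDiff_succ_iff_deriv]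
  refine ⟨fun z => (hX.deriv₁ z).differentiableAt, by simp, ?_⟩
  rw [hX.deriv_fst]; exact h1

theorem IsJet.deriv_comp {X : Jet} (hX : IsJet X) (τ : ℝ) :
    (deriv fun z => X.1 (z - τ)) = fun z => X.2.1 (z - τ) := by
  funext z
  rw [deriv_comp_sub_const, hX.deriv_fst]

theorem IsJet.deriv_deriv_comp {X : Jet} (hX : IsJet X) (τ : ℝ) :
    deriv (deriv fun z => X.1 (z - τ)) = fun z => X.2.2 (z - τ) := by
  rw [hX.deriv_comp]
  funext z
  rw [deriv_comp_sub_const, hX.deriv_snd]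

namespace PTParams

variable (P : PTParams)

/-- The linear coupling and damping terms of one equation. -/
def coupling (b η g : ℝ) : Jet × Jet →L[ℝ] BC :=
  let Y : Jet × Jet →L[ℝ] Jet := .snd ℝ _ _
  let Y₀ : Jet × Jet →L[ℝ] BC := .fst ℝ _ _ ∘L Y
  let Y₂ : Jet × Jet →L[ℝ] BC := .snd ℝ _ _ ∘L .snd ℝ _ _ ∘L Y
  let X₁ : Jet × Jet →L[ℝ] BC := .fst ℝ _ _ ∘L .snd ℝ _ _ ∘L .fst ℝ _ _
  (-P.lamM') • (shift b ∘L Y₂) - P.lamM • (shift η ∘L Y₂) - P.lamE' • (shift b ∘L Y₀)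
    - P.lamE • (shift η ∘L Y₀) - g • X₁

theorem coupling_apply (b η g : ℝ) (X Y : Jet) (z : ℝ) : P.coupling b η g (X, Y) z =
    -P.lamM' * Y.2.2 (z + b) - P.lamM * Y.2.2 (z + η) - P.lamE' * Y.1 (z + b)
      - P.lamE * Y.1 (z + η) - g * X.2.1 z := rfl

/-- The linear coupling and damping terms of both equations, the components being shifted relative
to each other by `η`. -/
def coupling₂ (η : ℝ) : Jet × Jet →L[ℝ] BC × BC :=
  (P.coupling (η - P.p) η P.γ).prod
    ((P.coupling (P.p - η) (-η) (-P.γ)) ∘L (.prod (.snd ℝ _ _) (.fst ℝ _ _)))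

theorem coupling₂_fst (η : ℝ) (X Y : Jet) :
    (P.coupling₂ η (X, Y)).1 = P.coupling (η - P.p) η P.γ (X, Y) := rfl

theorem coupling₂_snd (η : ℝ) (X Y : Jet) :
    (P.coupling₂ η (X, Y)).2 = P.coupling (P.p - η) (-η) (-P.γ) (Y, X) := rfl

/-- The terms of higher order in the equations for a perturbation of size `ε`. -/
def remainder (η : ℝ) (V : Jet × Jet) : BC × BC :=
  P.coupling₂ η V - P.a • (V.1.1 * V.1.1, V.2.1 * V.2.1)

theorem contDiff_remainder (η : ℝ) : ContDiff ℝ 1 (P.remainder η) := by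
  have h1 : ContDiff ℝ 1 fun V : Jet × Jet => V.1.1 := contDiff_fst.comp contDiff_fst
  have h2 : ContDiff ℝ 1 fun V : Jet × Jet => V.2.1 := contDiff_fst.comp contDiff_snd
  exact (P.coupling₂ η).contDiff.sub (((h1.mul h1).prodMk (h2.mul h2)).const_smul P.a)

/-- The forcing term. -/
def force (τ : ℝ) : BC :=
  BoundedContinuousFunction.ofNormedAddCommGroup (fun z => Real.sin (P.Ω * (z + τ)))
    (by fun_prop) 1 fun z => Real.abs_sin_le_one _

@[simp] theorem force_apply (τ z : ℝ) : P.force τ z = Real.sin (P.Ω * (z + τ)) := rfl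

/-- The first-order perturbation evaluated at a solution `(Q, Q)` of the uncoupled system. -/
def inhom (τ₁ τ₂ : ℝ) (Q : Jet) : BC × BC :=
  P.coupling₂ (τ₁ - τ₂) (Q, Q) + (P.force τ₁, P.force τ₂)

/-- The system for jets centred at `τ₁` and `τ₂`. -/
structure SolvesJets (τ₁ τ₂ ε : ℝ) (U V : Jet) : Prop where
  isJet₁ : IsJet U
  isJet₂ : IsJet V
  eq₁ : ∀ z, U.2.2 z + U.1 z + P.a * U.1 z ^ 2 =
    ε * ((P.coupling₂ (τ₁ - τ₂) (U, V)).1 z + P.force τ₁ z)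
  eq₂ : ∀ z, V.2.2 z + V.1 z + P.a * V.1 z ^ 2 =
    ε * ((P.coupling₂ (τ₁ - τ₂) (U, V)).2 z + P.force τ₂ z)

variable {P}

/-- Undoes the centring: the relative shifts `τ₁ - τ₂ - p` and `p - (τ₁ - τ₂)` become the delay `-p`
and the advance `p`. -/
theorem SolvesJets.isSolution {τ₁ τ₂ ε : ℝ} {U V : Jet} (h : P.SolvesJets τ₁ τ₂ ε U V)
    (hβ : P.β = 0) : P.IsSolution ε (fun z => U.1 (z - τ₁)) (fun z => V.1 (z - τ₂)) := by
  refine ⟨h.isJet₁.contDiff.comp (contDiff_id.sub contDiff_const),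
    h.isJet₂.contDiff.comp (contDiff_id.sub contDiff_const), fun z => ?_, fun z => ?_⟩
  · rw [h.isJet₁.deriv_deriv_comp, h.isJet₂.deriv_deriv_comp, h.isJet₁.deriv_comp, hβ]
    have := h.eq₁ (z - τ₁)
    rw [coupling₂_fst, coupling_apply, force_apply] at this
    simp only [show z - τ₁ + (τ₁ - τ₂ - P.p) = z - P.p - τ₂ by ring,
      show z - τ₁ + (τ₁ - τ₂) = z - τ₂ by ring, sub_add_cancel] at this
    linear_combination this
  · rw [h.isJet₁.deriv_deriv_comp, h.isJet₂.deriv_deriv_comp, h.isJet₂.deriv_comp, hβ]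
    have := h.eq₂ (z - τ₂)
    rw [coupling₂_snd, coupling_apply, force_apply] at this
    simp only [show z - τ₂ + (P.p - (τ₁ - τ₂)) = z + P.p - τ₁ by ring,
      show z - τ₂ + -(τ₁ - τ₂) = z - τ₁ by ring, sub_add_cancel] at this
    linear_combination this

theorem solvesJets_of_perturbation {τ₁ τ₂ ε : ℝ} {Q X Y : Jet} (hQ : IsJet Q) (hX : IsJet X)
    (hY : IsJet Y) (hQ₀ : ∀ z, Q.2.2 z + Q.1 z + P.a * Q.1 z ^ 2 = 0)
    (hX₀ : ∀ z, X.2.2 z + X.1 z + 2 * P.a * Q.1 z * X.1 z =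
      (P.inhom τ₁ τ₂ Q).1 z + ε * (P.remainder (τ₁ - τ₂) (X, Y)).1 z)
    (hY₀ : ∀ z, Y.2.2 z + Y.1 z + 2 * P.a * Q.1 z * Y.1 z =
      (P.inhom τ₁ τ₂ Q).2 z + ε * (P.remainder (τ₁ - τ₂) (X, Y)).2 z) :
    P.SolvesJets τ₁ τ₂ ε (Q + ε • X) (Q + ε • Y) := by
  have hc : P.coupling₂ (τ₁ - τ₂) (Q + ε • X, Q + ε • Y) =
      P.coupling₂ (τ₁ - τ₂) (Q, Q) + ε • P.coupling₂ (τ₁ - τ₂) (X, Y) := by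
    rw [← map_smul, ← map_add]; rfl
  refine ⟨hQ.add_smul hX ε, hQ.add_smul hY ε, fun z => ?_, fun z => ?_⟩
  · have h1 := hQ₀ z
    have h2 := hX₀ z
    rw [hc]
    simp only [inhom, remainder, Prod.fst_add, Prod.fst_sub, Prod.smul_fst,
      BoundedContinuousFunction.coe_add, Pi.add_apply, BoundedContinuousFunction.coe_sub,
      Pi.sub_apply, BoundedContinuousFunction.coe_smul, smul_eq_mul, Prod.snd_add, Prod.smul_snd,
      BoundedContinuousFunction.coe_mul, Pi.mul_apply] at h2 ⊢
    linear_combination h1 + ε * h2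
  · have h1 := hQ₀ z
    have h2 := hY₀ z
    rw [hc]
    simp only [inhom, remainder, Prod.fst_add, Prod.snd_sub, Prod.smul_fst,
      BoundedContinuousFunction.coe_add, Pi.add_apply, BoundedContinuousFunction.coe_sub,
      Pi.sub_apply, BoundedContinuousFunction.coe_smul, smul_eq_mul, Prod.snd_add, Prod.smul_snd,
      BoundedContinuousFunction.coe_mul, Pi.mul_apply] at h2 ⊢
    linear_combination h1 + ε * h2

theorem abs_coupling_le {c : ℝ} (hc : |P.lamM'| + |P.lamM| + |P.lamE'| + |P.lamE| + |P.γ| ≤ c)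
    (b η g : ℝ) (hg : |g| = |P.γ|) (X Y : Jet) (z : ℝ) : |P.coupling b η g (X, Y) z| ≤
      c * (|Y.2.2 (z + b)| + |Y.2.2 (z + η)| + |Y.1 (z + b)| + |Y.1 (z + η)| + |X.2.1 z|) := by
  rw [coupling_apply]
  have h1 := abs_nonneg P.lamM'
  have h2 := abs_nonneg P.lamM
  have h3 := abs_nonneg P.lamE'
  have h4 := abs_nonneg P.lamE
  have h5 := abs_nonneg P.γ
  calc _ ≤ |P.lamM'| * |Y.2.2 (z + b)| + |P.lamM| * |Y.2.2 (z + η)| + |P.lamE'| * |Y.1 (z + b)|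
        + |P.lamE| * |Y.1 (z + η)| + |P.γ| * |X.2.1 z| := by
        rw [← hg, ← abs_mul, ← abs_mul, ← abs_mul, ← abs_mul, ← abs_mul]
        refine (abs_sub _ _).trans (add_le_add_left ?_ _)
        refine (abs_sub _ _).trans (add_le_add_left ?_ _)
        refine (abs_sub _ _).trans (add_le_add_left ?_ _)
        refine (abs_sub _ _).trans (add_le_add_left ?_ _)
        rw [neg_mul, abs_neg]
    _ ≤ c * |Y.2.2 (z + b)| + c * |Y.2.2 (z + η)| + c * |Y.1 (z + b)| + c * |Y.1 (z + η)|
        + c * |X.2.1 z| := by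
        gcongr <;> linarith
    _ = _ := by ring

/-- With `D = U - U'`, subtracting the equations gives `D'' + D + a (U + U') D = ε (…)`. Since `U`
and `U'` are near `-1/a` far out, moving `-2D` to the left exposes the small coefficient `a (U + U'
+ 2/a)`. The forcing cancels. -/
theorem SolvesJets.smallCoupling {τ₁ τ₂ ε c : ℝ} {U V U' V' : Jet}
    (h : P.SolvesJets τ₁ τ₂ ε U V) (h' : P.SolvesJets τ₁ τ₂ ε U' V') (ha : P.a ≠ 0)
    (hc : |P.lamM'| + |P.lamM| + |P.lamE'| + |P.lamE| + |P.γ| ≤ c) :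
    SmallCoupling (fun z => |P.a| * |U.1 z + U'.1 z + 2 / P.a|) (|ε| * c) (τ₁ - τ₂ - P.p)
      (τ₁ - τ₂) (U - U') (V - V') ∧
    SmallCoupling (fun z => |P.a| * |V.1 z + V'.1 z + 2 / P.a|) (|ε| * c) (P.p - (τ₁ - τ₂))
      (-(τ₁ - τ₂)) (V - V') (U - U') := by
  have hd : P.coupling₂ (τ₁ - τ₂) (U - U', V - V') =
      P.coupling₂ (τ₁ - τ₂) (U, V) - P.coupling₂ (τ₁ - τ₂) (U', V') := by
    rw [← map_sub]; rfl
  constructor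
  · intro z
    have e : (U - U').2.2 z - (U - U').1 z =
        ε * P.coupling (τ₁ - τ₂ - P.p) (τ₁ - τ₂) P.γ (U - U', V - V') z
          - P.a * (U.1 z + U'.1 z + 2 / P.a) * (U - U').1 z := by
      have h1 := h.eq₁ z
      have h2 := h'.eq₁ z
      rw [← coupling₂_fst, hd]
      simp only [Prod.fst_sub, Prod.snd_sub, BoundedContinuousFunction.coe_sub, Pi.sub_apply]
      field_simp
      linear_combination h1 - h2
    rw [e]
    refine (abs_sub _ _).trans ?_
    rw [abs_mul, abs_mul, abs_mul, add_comm, mul_assoc |ε|]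
    exact add_le_add_right (mul_le_mul_of_nonneg_left
      (P.abs_coupling_le hc _ _ _ rfl _ _ z) (abs_nonneg _)) _
  · intro z
    have e : (V - V').2.2 z - (V - V').1 z =
        ε * P.coupling (P.p - (τ₁ - τ₂)) (-(τ₁ - τ₂)) (-P.γ) (V - V', U - U') z
          - P.a * (V.1 z + V'.1 z + 2 / P.a) * (V - V').1 z := by
      have h1 := h.eq₂ z
      have h2 := h'.eq₂ z
      rw [← coupling₂_snd, hd]
      simp only [Prod.fst_sub, Prod.snd_sub, BoundedContinuousFunction.coe_sub, Pi.sub_apply]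
      field_simp
      linear_combination h1 - h2
    rw [e]
    refine (abs_sub _ _).trans ?_
    rw [abs_mul, abs_mul, abs_mul, add_comm, mul_assoc |ε|]
    exact add_le_add_right (mul_le_mul_of_nonneg_left
      (P.abs_coupling_le hc _ _ _ (abs_neg _) _ _ z) (abs_nonneg _)) _

/-! ### The equilibrium and the homoclinic orbit as jets -/

variable (P)

/-- The jet of the equilibrium. -/
def eqJet : Jet := (BoundedContinuousFunction.const ℝ (-1 / P.a), 0, 0)

/-- The jet of the homoclinic solution. -/
def qJet : Jet :=
  (BoundedContinuousFunction.const ℝ (-1 / P.a) + (3 / (2 * P.a)) • scB,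
    (-(3 / (2 * P.a))) • jetST.1, (-(3 / (2 * P.a))) • jetST.2.1)

theorem isJet_eqJet : IsJet P.eqJet :=
  ⟨fun z => hasDerivAt_const z _, fun z => hasDerivAt_const z _⟩

theorem isJet_qJet : IsJet P.qJet := by
  constructor
  · intro z
    refine (((hasDerivAt_sc z).const_mul (3 / (2 * P.a))).const_add (-1 / P.a)).congr_deriv ?_
    simp [qJet, jetST]
  · intro z
    exact (isJet_jetST.deriv₁ z).const_mul _

theorem qJet_fst (z : ℝ) : P.qJet.1 z = P.qh z := by
  simp [qJet, qh, sc]; ring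

theorem qJet_snd (z : ℝ) : P.qJet.2.1 z = P.ph z := by
  simp [qJet, ph, jetST, sc, th]; ring

theorem qJet_fst' (z : ℝ) : P.qJet.1 z = -1 / P.a + 3 / (2 * P.a) * sc z := by
  simp [qJet]

theorem ph_eq (z : ℝ) : P.ph z = -(3 / (2 * P.a)) * st z := by
  rw [← qJet_snd]; rfl

theorem coe_qJet_snd : ⇑P.qJet.2.1 = P.ph := funext P.qJet_snd

theorem qJet_trd (z : ℝ) : P.qJet.2.2 z = deriv P.ph z := by
  rw [← coe_qJet_snd, P.isJet_qJet.deriv_snd]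

variable {P}

theorem eqJet_equation (ha : P.a ≠ 0) (z : ℝ) :
    P.eqJet.2.2 z + P.eqJet.1 z + P.a * P.eqJet.1 z ^ 2 = 0 := by
  simp [eqJet]; field_simp; ring

theorem qJet_equation (ha : P.a ≠ 0) (z : ℝ) :
    P.qJet.2.2 z + P.qJet.1 z + P.a * P.qJet.1 z ^ 2 = 0 := by
  rw [qJet_fst']
  simp only [qJet, jetST, BoundedContinuousFunction.coe_smul, smul_eq_mul,
    BoundedContinuousFunction.coe_sub, Pi.sub_apply,
    BoundedContinuousFunction.coe_mul, Pi.mul_apply, scB_apply, thB_apply]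
  field_simp
  rw [sc_eq]; ring

theorem norm_phase_sub_le {τ₁ τ₂ ε C : ℝ} {Q X Y : Jet} (hQ : IsJet Q) (hX : IsJet X)
    (hY : IsJet Y) (hXC : ‖X‖ ≤ C) (hYC : ‖Y‖ ≤ C) (z : ℝ) :
    ‖phase (fun z => (Q + ε • X).1 (z - τ₁)) (fun z => (Q + ε • Y).1 (z - τ₂)) z -
      (Q.2.1 (z - τ₁), Q.1 (z - τ₁), Q.2.1 (z - τ₂), Q.1 (z - τ₂))‖ ≤ C * |ε| := by
  have key : ∀ (f : BC) (x y : ℝ), ‖f‖ ≤ C → ‖y + ε * f x - y‖ ≤ C * |ε| := fun f x y hf => by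
    rw [add_sub_cancel_left, norm_mul, mul_comm]
    exact mul_le_mul_of_nonneg_right ((f.abs_le x).trans hf) (abs_nonneg ε)
  unfold phase
  rw [(hQ.add_smul hX ε).deriv_comp, (hQ.add_smul hY ε).deriv_comp]
  refine norm_prod_le_iff.2 ⟨?_, norm_prod_le_iff.2 ⟨?_, norm_prod_le_iff.2 ⟨?_, ?_⟩⟩⟩
  · exact key X.2.1 _ _ (X.norm_snd_le.trans hXC)
  · exact key X.1 _ _ (X.norm_fst_le.trans hXC)
  · exact key Y.2.1 _ _ (Y.norm_snd_le.trans hYC)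
  · exact key Y.1 _ _ (Y.norm_fst_le.trans hYC)

theorem tendsto_phase_sub {l : Filter ℝ} (hl : ∀ τ : ℝ, Tendsto (fun z => z - τ) l l)
    {τ₁ τ₂ : ℝ} {U V U' V' : Jet} (hU : IsJet U) (hV : IsJet V) (hU' : IsJet U') (hV' : IsJet V')
    (h : (Tendsto (U - U').1 l (𝓝 0) ∧ Tendsto (U - U').2.1 l (𝓝 0)) ∧
      (Tendsto (V - V').1 l (𝓝 0) ∧ Tendsto (V - V').2.1 l (𝓝 0))) :
    Tendsto (fun z => phase (fun z => U.1 (z - τ₁)) (fun z => V.1 (z - τ₂)) z -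
      phase (fun z => U'.1 (z - τ₁)) (fun z => V'.1 (z - τ₂)) z) l (𝓝 0) := by
  unfold phase
  rw [hU.deriv_comp, hV.deriv_comp, hU'.deriv_comp, hV'.deriv_comp]
  exact (h.1.2.comp (hl τ₁)).prodMk_nhds ((h.1.1.comp (hl τ₁)).prodMk_nhds
    ((h.2.2.comp (hl τ₂)).prodMk_nhds (h.2.1.comp (hl τ₂))))

end PTParams

/-! ### Translation invariance, and persistence under nondegeneracy -/

theorem IsJet.sub {X Y : Jet} (hX : IsJet X) (hY : IsJet Y) : IsJet (X - Y) :=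
  ⟨fun z => (hX.deriv₁ z).sub (hY.deriv₁ z), fun z => (hX.deriv₂ z).sub (hY.deriv₂ z)⟩

namespace PTParams

variable {P : PTParams}

theorem remainder_shiftJet (η T : ℝ) (V : Jet × Jet) :
    P.remainder η (shiftJet T V.1, shiftJet T V.2) =
      (shift T (P.remainder η V).1, shift T (P.remainder η V).2) := by
  obtain ⟨X, Y⟩ := V
  ext z
  · simp only [remainder, Prod.fst_sub, Prod.smul_fst, coupling₂_fst, coupling_apply,
      BoundedContinuousFunction.coe_sub, Pi.sub_apply, BoundedContinuousFunction.coe_smul,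
      smul_eq_mul, BoundedContinuousFunction.coe_mul, Pi.mul_apply, shift_apply, shiftJet]
    simp only [add_right_comm z _ T]
  · simp only [remainder, Prod.snd_sub, Prod.smul_snd, coupling₂_snd, coupling_apply,
      BoundedContinuousFunction.coe_sub, Pi.sub_apply, BoundedContinuousFunction.coe_smul,
      smul_eq_mul, BoundedContinuousFunction.coe_mul, Pi.mul_apply, shift_apply, shiftJet]
    simp only [add_right_comm z _ T]

theorem shift_force (hΩ : P.Ω ≠ 0) (τ : ℝ) :
    shift (2 * Real.pi / P.Ω) (P.force τ) = P.force τ := by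
  ext z
  rw [shift_apply, force_apply, force_apply, ← Real.sin_add_two_pi (P.Ω * (z + τ))]
  congr 1
  field_simp
  ring

/-- On the constant equilibrium the coupling is constant, so only the periodic forcing depends on
`z`. -/
theorem inhom_eqJet_fst_shift (hΩ : P.Ω ≠ 0) (τ₁ τ₂ : ℝ) :
    shift (2 * Real.pi / P.Ω) (P.inhom τ₁ τ₂ P.eqJet).1 = (P.inhom τ₁ τ₂ P.eqJet).1 := by
  have : (P.inhom τ₁ τ₂ P.eqJet).1 = P.coupling (τ₁ - τ₂ - P.p) (τ₁ - τ₂) P.γ (P.eqJet, P.eqJet) +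
    P.force τ₁ := rfl
  rw [this, map_add, shift_force hΩ]
  rfl

theorem inhom_eqJet_snd_shift (hΩ : P.Ω ≠ 0) (τ₁ τ₂ : ℝ) :
    shift (2 * Real.pi / P.Ω) (P.inhom τ₁ τ₂ P.eqJet).2 = (P.inhom τ₁ τ₂ P.eqJet).2 := by
  have : (P.inhom τ₁ τ₂ P.eqJet).2 =
    P.coupling (P.p - (τ₁ - τ₂)) (-(τ₁ - τ₂)) (-P.γ) (P.eqJet, P.eqJet) + P.force τ₂ := rfl
  rw [this, map_add, shift_force hΩ]
  rfl

theorem abs_sum_le {a ε r x y C : ℝ} (ha : a ≠ 0) (hx : |x| ≤ C) (hy : |y| ≤ C)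
    (hr : |a| * |r| ≤ 1 / 32) (hε : |a| * (|ε| * (2 * C)) ≤ 1 / 32) :
    |a| * |(-1 / a + r + ε * x) + (-1 / a + ε * y) + 2 / a| ≤ 1 / 16 := by
  have e : (-1 / a + r + ε * x) + (-1 / a + ε * y) + 2 / a = r + ε * (x + y) := by
    field_simp; ring
  rw [e]
  have h1 : |r + ε * (x + y)| ≤ |r| + |ε| * (2 * C) := by
    refine (abs_add_le _ _).trans (add_le_add_right ?_ _)
    rw [abs_mul]
    exact mul_le_mul_of_nonneg_left ((abs_add_le _ _).trans (by linarith)) (abs_nonneg _)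
  have := mul_le_mul_of_nonneg_left h1 (abs_nonneg a)
  linarith

/-- Persistence of the homoclinic orbit, from the solvability conditions and their
nondegeneracy. -/
theorem persists_of_nondegenerate (ha : P.a ≠ 0) (hβ : P.β = 0) (hΩ : P.Ω ≠ 0) (τ₁ τ₂ : ℝ)
    (hN₁ : solv (P.inhom τ₁ τ₂ P.qJet).1 = 0) (hN₂ : solv (P.inhom τ₁ τ₂ P.qJet).2 = 0)
    (A : (ℝ × ℝ) ≃L[ℝ] (ℝ × ℝ))
    (hA : ∀ X Y : Jet, IsJet X → IsJet Y → (∀ z, linOp X z = (P.inhom τ₁ τ₂ P.qJet).1 z) →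
      (∀ z, linOp Y z = (P.inhom τ₁ τ₂ P.qJet).2 z) → ∀ α : ℝ × ℝ,
      (solv (P.remainder (τ₁ - τ₂) (X + α.1 • (-(3 / (2 * P.a))) • jetST,
          Y + α.2 • (-(3 / (2 * P.a))) • jetST)).1,
        solv (P.remainder (τ₁ - τ₂) (X + α.1 • (-(3 / (2 * P.a))) • jetST,
          Y + α.2 • (-(3 / (2 * P.a))) • jetST)).2) =
        (solv (P.remainder (τ₁ - τ₂) (X, Y)).1, solv (P.remainder (τ₁ - τ₂) (X, Y)).2) + A α) :
    P.Persists τ₁ τ₂ := by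
  obtain ⟨ε₁, hε₁, C₁, hper⟩ := exists_periodic_branch (P.contDiff_remainder (τ₁ - τ₂))
    (2 * Real.pi / P.Ω) (remainder_shiftJet _ _) (P.inhom τ₁ τ₂ P.eqJet)
    (inhom_eqJet_fst_shift hΩ _ _) (inhom_eqJet_snd_shift hΩ _ _)
  obtain ⟨ε₂, hε₂, C₂, hhom⟩ := exists_homoclinic_branch (P.contDiff_remainder (τ₁ - τ₂))
    (P.inhom τ₁ τ₂ P.qJet) hN₁ hN₂ _ A hA
  set c := |P.lamM'| + |P.lamM| + |P.lamE'| + |P.lamE| + |P.γ| with hc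
  have hc0 : 0 ≤ c := by positivity
  set C := max C₁ C₂ with hC
  have hsmall : ∀ d : ℝ, 0 ≤ d → ∀ δ > 0, ∃ ε₀ > 0, ∀ ε : ℝ, |ε| < ε₀ → |ε| * d ≤ δ := by
    intro d hd δ hδ
    -- The `+ 1` covers `d = 0`.
    refine ⟨δ / (d + 1), by positivity, fun ε hε => ?_⟩
    rw [lt_div_iff₀ (by positivity)] at hε
    nlinarith [abs_nonneg ε]
  obtain ⟨ε₃, hε₃, hs₃⟩ := hsmall c hc0 (1 / 80) (by norm_num)
  obtain ⟨ε₄, hε₄, hs₄⟩ := hsmall (|P.a| * (2 * |C|)) (by positivity) (1 / 32) (by norm_num)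
  refine ⟨min (min ε₁ ε₂) (min ε₃ ε₄), by positivity, C, fun ε _ hε => ?_⟩
  simp only [lt_min_iff] at hε
  obtain ⟨X', Y', hX', hY', hXC', hYC', eX', eY', hXT, hYT⟩ := hper ε hε.1.1
  obtain ⟨X, Y, hX, hY, hXC, hYC, eX, eY⟩ := hhom ε hε.1.2
  replace hXC := hXC.trans (le_max_right C₁ C₂)
  replace hYC := hYC.trans (le_max_right C₁ C₂)
  replace hXC' := hXC'.trans (le_max_left C₁ C₂)
  replace hYC' := hYC'.trans (le_max_left C₁ C₂)
  have hCC : C ≤ |C| := le_abs_self C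
  have S' : P.SolvesJets τ₁ τ₂ ε (P.eqJet + ε • X') (P.eqJet + ε • Y') := by
    refine solvesJets_of_perturbation P.isJet_eqJet hX' hY' (eqJet_equation ha)
      (fun z => ?_) (fun z => ?_)
    · rw [← eX' z]
      simp [eqJet]; field_simp; ring
    · rw [← eY' z]
      simp [eqJet]; field_simp; ring
  have S : P.SolvesJets τ₁ τ₂ ε (P.qJet + ε • X) (P.qJet + ε • Y) := by
    refine solvesJets_of_perturbation P.isJet_qJet hX hY (qJet_equation ha)
      (fun z => ?_) (fun z => ?_)
    · rw [← eX z, qJet_fst', linOp]; field_simp; ring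
    · rw [← eY z, qJet_fst', linOp]; field_simp; ring
  -- The budget `1/16` splits evenly between the tail of the pulse and the `O(ε)` corrections.
  have hκ : ∀ (l : Filter ℝ), Tendsto sc l (𝓝 0) → ∀ W W' : Jet, ‖W‖ ≤ C → ‖W'‖ ≤ C →
      ∀ᶠ z in l, |P.a| * |(P.qJet + ε • W).1 z + (P.eqJet + ε • W').1 z + 2 / P.a| ≤ 1 / 16 := by
    intro l hl W W' hW hW'
    have ht : Tendsto (fun z => |P.a| * |3 / (2 * P.a) * sc z|) l (𝓝 0) := by
      simpa using (hl.const_mul (3 / (2 * P.a))).abs.const_mul |P.a|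
    filter_upwards [ht.eventually (ge_mem_nhds (show (0 : ℝ) < 1 / 32 by norm_num))] with z hz
    have := abs_sum_le (x := W.1 z) (y := W'.1 z) (C := |C|) (ε := ε) ha
      ((BC.abs_le _ z).trans (W.norm_fst_le.trans (hW.trans hCC)))
      ((BC.abs_le _ z).trans (W'.norm_fst_le.trans (hW'.trans hCC))) hz
      (by have := hs₄ ε hε.2.2; linarith)
    rw [← qJet_fst'] at this
    exact this
  obtain ⟨sc₁, sc₂⟩ := S.smallCoupling S' ha (c := c) le_rfl
  have hper' : ∀ (W : Jet), shiftJet (2 * Real.pi / P.Ω) W = W → ∀ τ,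
      Function.Periodic (fun z => (P.eqJet + ε • W).1 (z - τ)) (2 * Real.pi / P.Ω) := by
    intro W hW τ z
    have := DFunLike.congr_fun (congrArg Prod.fst hW) (z - τ)
    change W.1 (z - τ + _) = _ at this
    change -1 / P.a + ε * W.1 _ = -1 / P.a + ε * W.1 _
    rw [← this]
    congr 3
    ring
  refine ⟨fun z => (P.qJet + ε • X).1 (z - τ₁), fun z => (P.qJet + ε • Y).1 (z - τ₂),
    fun z => (P.eqJet + ε • X').1 (z - τ₁), fun z => (P.eqJet + ε • Y').1 (z - τ₂),
    S.isSolution hβ, S'.isSolution hβ, hper' _ hXT _, hper' _ hYT _, fun z => ?_, fun z => ?_,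
    ?_, ?_⟩
  · exact norm_phase_sub_le (τ₁ := τ₁) (τ₂ := τ₂) P.isJet_eqJet hX' hY' hXC' hYC' z
  · have := norm_phase_sub_le (ε := ε) (τ₁ := τ₁) (τ₂ := τ₂) P.isJet_qJet hX hY hXC hYC z
    simpa only [qJet_fst, qJet_snd, homoclinic] using this
  · refine tendsto_phase_sub (fun τ => tendsto_atTop_add_const_right atTop (-τ) tendsto_id)
      S.isJet₁ S.isJet₂ S'.isJet₁ S'.isJet₂ ?_
    exact tendsto_zero_of_smallCoupling (S.isJet₁.sub S'.isJet₁) (S.isJet₂.sub S'.isJet₂) sc₁ sc₂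
      (hκ _ tendsto_sc_atTop _ _ hXC hXC') (hκ _ tendsto_sc_atTop _ _ hYC hYC') (hs₃ ε hε.2.1)
  · refine tendsto_phase_sub (fun τ => tendsto_atBot_add_const_right atBot (-τ) tendsto_id)
      S.isJet₁ S.isJet₂ S'.isJet₁ S'.isJet₂ ?_
    exact tendsto_zero_of_smallCoupling_atBot (S.isJet₁.sub S'.isJet₁) (S.isJet₂.sub S'.isJet₂)
      sc₁ sc₂ (hκ _ tendsto_sc_atBot _ _ hXC hXC') (hκ _ tendsto_sc_atBot _ _ hYC hYC')
      (hs₃ ε hε.2.1)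

end PTParams

/-! ### Correlation integrals with the kernel function -/

theorem integral_mul_deriv_eq_neg {φ φ' : ℝ → ℝ} (hd : ∀ z, HasDerivAt φ (φ' z) z)
    (hφ : Integrable φ) (hφ' : Integrable φ') {f f' : BC} (hf : ∀ z, HasDerivAt f (f' z) z) :
    ∫ z, φ z * f' z = -∫ z, φ' z * f z :=
  integral_mul_deriv_eq_deriv_mul_of_integrable (fun x _ => hd x) (fun x _ => hf x) (f'.integrable_mul hφ)
    (f.integrable_mul hφ') (f.integrable_mul hφ)

theorem solv_apply (f : BC) : solv f = ∫ z, st z * f z := rfl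

theorem integrable_jetST (f : BC) (hf : ∃ g : BC, f = scB * g) : Integrable f := by
  obtain ⟨g, rfl⟩ := hf
  exact integrable_sc_mul g.continuous g.abs_le

theorem integrable_jetST_snd : Integrable jetST.2.1 :=
  integrable_jetST _ ⟨(1 / 2 : ℝ) • scB - thB * thB, by ext z; simp [jetST]; ring⟩

theorem integrable_jetST_trd : Integrable jetST.2.2 :=
  integrable_jetST _ ⟨thB - (3 : ℝ) • (scB * thB), by ext z; simp [jetST]; ring⟩

theorem hasDerivAt_st (z : ℝ) : HasDerivAt st (jetST.2.1 z) z := isJet_jetST.deriv₁ z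

theorem integral_deriv_st_mul {f f' : BC} (hf : ∀ z, HasDerivAt f (f' z) z) :
    ∫ z, jetST.2.1 z * f z = -solv f' := by
  rw [solv_apply, integral_mul_deriv_eq_neg hasDerivAt_st integrable_st integrable_jetST_snd hf,
    neg_neg]

/-- Integration by parts shows that `∫ st st'` equals its own negative. -/
theorem solv_jetST_snd : solv jetST.2.1 = 0 := by
  have h := integral_deriv_st_mul (f := jetST.1) isJet_jetST.deriv₁
  have h2 : ∫ z, jetST.2.1 z * jetST.1 z = solv jetST.2.1 :=
    integral_congr_ae (ae_of_all _ fun z => mul_comm _ _)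
  linarith

/-- The third derivative of the kernel function. -/
def dddST : BC := jetST.2.1 - (3 : ℝ) • (scB * jetST.2.1) + (3 : ℝ) • (jetST.1 * jetST.1)

/-- Differentiating `st'' = st - 3 sc st` with `sc' = -st`; equivalently `L st' = 3 st²`, the source
of Green's identity below. -/
theorem hasDerivAt_jetST_trd (z : ℝ) : HasDerivAt jetST.2.2 (dddST z) z := by
  have h := (isJet_jetST.deriv₁ z).fun_sub
    (((hasDerivAt_sc z).fun_mul (isJet_jetST.deriv₁ z)).const_mul 3)
  refine h.congr_deriv ?_
  simp [dddST, jetST]; ring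

theorem integrable_dddST : Integrable dddST :=
  integrable_jetST _ ⟨(1 / 2 : ℝ) • scB - thB * thB - (3 : ℝ) • jetST.2.1 + (3 : ℝ) •
    (thB * jetST.1), by ext z; simp [dddST, jetST]; ring⟩

/-- Green's identity for the linearised operator and the derivative of the kernel function. -/
theorem integral_deriv_st_mul_linOp {X : Jet} (hX : IsJet X) {N : BC} (hN : ∀ z, linOp X z = N z) :
    ∫ z, jetST.2.1 z * N z = 3 * ∫ z, st z * (st z * X.1 z) := by
  have h1 : ∫ z, jetST.2.1 z * X.2.2 z = -∫ z, jetST.2.2 z * X.2.1 z :=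
    integral_mul_deriv_eq_neg isJet_jetST.deriv₂ integrable_jetST_snd integrable_jetST_trd
      hX.deriv₂
  have h2 : ∫ z, jetST.2.2 z * X.2.1 z = -∫ z, dddST z * X.1 z :=
    integral_mul_deriv_eq_neg hasDerivAt_jetST_trd integrable_jetST_trd integrable_dddST
      hX.deriv₁
  have h3 : ∀ z, jetST.2.1 z * N z = jetST.2.1 z * X.2.2 z +
      (3 * (st z * (st z * X.1 z)) - dddST z * X.1 z) := fun z => by
    rw [← hN, linOp]
    simp only [dddST, BoundedContinuousFunction.coe_add, Pi.add_apply,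
      BoundedContinuousFunction.coe_sub, Pi.sub_apply, BoundedContinuousFunction.coe_smul,
      smul_eq_mul, BoundedContinuousFunction.coe_mul, Pi.mul_apply, scB_apply]
    rw [show jetST.1 z = st z from rfl]
    ring
  have i1 : Integrable fun z => st z * (st z * X.1 z) := integrable_st_mul (jetST.1 * X.1)
  have i2 : Integrable fun z => dddST z * X.1 z := X.1.integrable_mul integrable_dddST
  have i3 : Integrable fun z => jetST.2.1 z * X.2.2 z := X.2.2.integrable_mul integrable_jetST_snd
  have i4 : Integrable fun z => 3 * (st z * (st z * X.1 z)) - dddST z * X.1 z :=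
    (i1.const_mul 3).sub i2
  rw [integral_congr_ae (ae_of_all _ h3), integral_add i3 i4,
    integral_sub (i1.const_mul 3) i2, integral_const_mul, h1, h2]
  ring

/-- Green's identity with `X = st`, for which `N = 0`. This removes the quadratic term in the kernel
amplitudes. -/
theorem integral_st_cube : ∫ z, st z * (st z * st z) = 0 := by
  have := integral_deriv_st_mul_linOp isJet_jetST (N := 0) linOp_jetST
  simp only [BoundedContinuousFunction.coe_zero, Pi.zero_apply, mul_zero, integral_zero] at this
  have h2 : ∫ z, st z * (st z * jetST.1 z) = ∫ z, st z * (st z * st z) := rfl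
  linarith

theorem hasDerivAt_solv_shift {f f' : BC} (hf : ∀ z, HasDerivAt f (f' z) z) (η : ℝ) :
    HasDerivAt (fun η => solv (shift η f)) (solv (shift η f')) η := by
  simp only [solv_apply, shift_apply]
  refine (hasDerivAt_integral_of_dominated_loc_of_deriv_le (F := fun η z => st z * f (z + η))
    (F' := fun η z => st z * f' (z + η)) (bound := fun z => |st z| * ‖f'‖) univ_mem
    (Eventually.of_forall fun x => ?_) (integrable_st_mul (shift η f)) ?_ ?_
    (integrable_st.abs.mul_const _) ?_).2
  · exact (integrable_st_mul (shift x f)).aestronglyMeasurable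
  · exact (integrable_st_mul (shift η f')).aestronglyMeasurable
  · refine ae_of_all _ fun z x _ => ?_
    rw [norm_mul]
    exact mul_le_mul_of_nonneg_left (f'.abs_le _) (abs_nonneg _)
  · refine ae_of_all _ fun z x _ => ?_
    have := (hf (z + x)).comp x ((hasDerivAt_id x).const_add z)
    exact (this.const_mul (st z)).congr_deriv (by ring)

theorem integral_st : ∫ z, st z = 0 := by
  have hd : ∀ x, HasDerivAt (fun z => -sc z) (st x) x := fun x => by
    simpa [st] using (hasDerivAt_sc x).fun_neg
  rw [integral_of_antideriv hd integrable_st tendsto_sc_atBot.neg tendsto_sc_atTop.neg]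
  simp

/-- Dominated convergence gives the limit `c ∫ st = 0`. The limit `c` may be nonzero, as it is for
`q`, which tends to `-1/a`. -/
theorem tendsto_solv_shift {f : BC} {c : ℝ} {l l' : Filter ℝ} [l.IsCountablyGenerated]
    (hl : ∀ z : ℝ, Tendsto (fun η => z + η) l l') (hf : Tendsto f l' (𝓝 c)) :
    Tendsto (fun η => solv (shift η f)) l (𝓝 0) := by
  have h0 : ∫ z, st z * c = 0 := by rw [integral_mul_const, integral_st, zero_mul]
  rw [← h0]
  simp only [solv_apply, shift_apply]
  refine tendsto_integral_filter_of_dominated_convergence (fun z => |st z| * ‖f‖)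
    (Eventually.of_forall fun η => (integrable_st_mul (shift η f)).aestronglyMeasurable)
    (Eventually.of_forall fun η => ae_of_all _ fun z => ?_) (integrable_st.abs.mul_const _)
    (ae_of_all _ fun z => (hf.comp (hl z)).const_mul _)
  rw [norm_mul]
  exact mul_le_mul_of_nonneg_left (f.abs_le _) (abs_nonneg _)

theorem st_neg (z : ℝ) : st (-z) = -st z := by simp [st, sc_neg, th_neg]

theorem integral_st_mul_cos (ω : ℝ) : ∫ z, st z * Real.cos (ω * z) = 0 := by
  have h := integral_neg_eq_self (fun z => st z * Real.cos (ω * z)) volume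
  simp only [st_neg, mul_neg, Real.cos_neg, neg_mul, integral_neg] at h
  linarith

theorem integrable_st_mul_sin (ω : ℝ) : Integrable fun z => st z * Real.sin (ω * z) :=
  integrable_st.mul_bdd (by fun_prop) (ae_of_all _ fun z => Real.abs_sin_le_one _)

theorem integrable_st_mul_cos (ω : ℝ) : Integrable fun z => st z * Real.cos (ω * z) :=
  integrable_st.mul_bdd (by fun_prop) (ae_of_all _ fun z => Real.abs_cos_le_one _)

/-- Addition formula; the cosine integral vanishes because `st` is odd. -/
theorem integral_st_mul_sin_add (ω τ : ℝ) : ∫ z, st z * Real.sin (ω * (z + τ)) =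
    (∫ z, st z * Real.sin (ω * z)) * Real.cos (ω * τ) := by
  have e : ∀ z, st z * Real.sin (ω * (z + τ)) = st z * Real.sin (ω * z) * Real.cos (ω * τ) +
      st z * Real.cos (ω * z) * Real.sin (ω * τ) := fun z => by
    rw [mul_add, Real.sin_add]; ring
  rw [integral_congr_ae (ae_of_all _ e), integral_add ((integrable_st_mul_sin ω).mul_const _)
    ((integrable_st_mul_cos ω).mul_const _), integral_mul_const, integral_mul_const,
    integral_st_mul_cos, zero_mul, add_zero]

theorem integral_st_mul_cos_add (ω τ : ℝ) : ∫ z, st z * Real.cos (ω * (z + τ)) =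
    -(∫ z, st z * Real.sin (ω * z)) * Real.sin (ω * τ) := by
  have e : ∀ z, st z * Real.cos (ω * (z + τ)) = st z * Real.cos (ω * z) * Real.cos (ω * τ) -
      st z * Real.sin (ω * z) * Real.sin (ω * τ) := fun z => by
    rw [mul_add, Real.cos_add]; ring
  rw [integral_congr_ae (ae_of_all _ e), integral_sub ((integrable_st_mul_cos ω).mul_const _)
    ((integrable_st_mul_sin ω).mul_const _), integral_mul_const, integral_mul_const,
    integral_st_mul_cos]
  ring

namespace PTParams

variable (P : PTParams)

/-! ### The Melnikov functions -/

/-- The jet of `ph`, the derivative of the homoclinic solution. -/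
def pJet : Jet := (-(3 / (2 * P.a))) • jetST

/-- The sine transform of the kernel function at the forcing frequency. -/
def sineAmp : ℝ := ∫ z, st z * Real.sin (P.Ω * z)

theorem hasDerivAt_qJet_fst (z : ℝ) : HasDerivAt P.qJet.1 (P.pJet.1 z) z := P.isJet_qJet.deriv₁ z

theorem hasDerivAt_qJet_trd (z : ℝ) : HasDerivAt P.qJet.2.2 (P.pJet.2.2 z) z :=
  (isJet_jetST.deriv₂ z).const_mul _

theorem solv_coupling (b η g : ℝ) (X Y : Jet) : solv (P.coupling b η g (X, Y)) =
    -P.lamM' * solv (shift b Y.2.2) - P.lamM * solv (shift η Y.2.2)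
      - P.lamE' * solv (shift b Y.1) - P.lamE * solv (shift η Y.1) - g * solv X.2.1 := by
  simp [coupling]

theorem integral_ph_mul (f : ℝ → ℝ) :
    ∫ z, P.ph z * f z = -(3 / (2 * P.a)) * ∫ z, st z * f z := by
  rw [← integral_const_mul]
  exact integral_congr_ae (ae_of_all _ fun z => by simp only [ph_eq]; ring)

theorem M₁₁_eq (η : ℝ) : P.M₁₁ η =
    -(3 / (2 * P.a)) * solv (P.coupling (η - P.p) η P.γ (P.qJet, P.qJet)) := by
  rw [M₁₁, integral_ph_mul, solv_apply]
  congr 1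
  refine integral_congr_ae (ae_of_all _ fun z => ?_)
  simp only [coupling_apply, qJet_trd, qJet_fst, qJet_snd, add_sub_assoc]

theorem M₂₁_eq (η : ℝ) : P.M₂₁ η =
    -(3 / (2 * P.a)) * solv (P.coupling (P.p - η) (-η) (-P.γ) (P.qJet, P.qJet)) := by
  rw [M₂₁, integral_ph_mul, solv_apply]
  congr 1
  refine integral_congr_ae (ae_of_all _ fun z => ?_)
  simp only [coupling_apply, qJet_trd, qJet_fst, qJet_snd]
  rw [show z - η = z + -η by ring, show z + -η + P.p = z + (P.p - η) by ring]
  ring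

theorem M₁₂_eq : P.M₁₂ = -(3 / (2 * P.a)) * P.sineAmp := P.integral_ph_mul _

theorem M₂₂_eq : P.M₂₂ = P.M₁₂ := rfl

theorem solv_force (τ : ℝ) : solv (P.force τ) = P.sineAmp * Real.cos (P.Ω * τ) :=
  integral_st_mul_sin_add _ _

theorem inhom_fst (τ₁ τ₂ : ℝ) (Q : Jet) : (P.inhom τ₁ τ₂ Q).1 =
    P.coupling (τ₁ - τ₂ - P.p) (τ₁ - τ₂) P.γ (Q, Q) + P.force τ₁ := rfl

theorem inhom_snd (τ₁ τ₂ : ℝ) (Q : Jet) : (P.inhom τ₁ τ₂ Q).2 =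
    P.coupling (P.p - (τ₁ - τ₂)) (-(τ₁ - τ₂)) (-P.γ) (Q, Q) + P.force τ₂ := rfl

/-- Translating `z` by `τ₁` turns the Melnikov integral into the solvability functional, up to the
factor relating `ph` to `st`. -/
theorem melnikov₁_eq_solv (τ₁ τ₂ : ℝ) :
    P.melnikov₁ τ₁ τ₂ = -(3 / (2 * P.a)) * solv (P.inhom τ₁ τ₂ P.qJet).1 := by
  rw [melnikov₁, ← integral_add_right_eq_self _ τ₁, solv_apply]
  simp only [add_sub_cancel_right]
  rw [integral_ph_mul]
  congr 1
  refine integral_congr_ae (ae_of_all _ fun z => ?_)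
  simp only [inhom_fst, BoundedContinuousFunction.coe_add, Pi.add_apply, coupling_apply, qJet_trd,
    qJet_fst, qJet_snd, force_apply]
  rw [show z + τ₁ - τ₂ = z + (τ₁ - τ₂) by ring, add_sub_assoc]

theorem melnikov₂_eq_solv (τ₁ τ₂ : ℝ) :
    P.melnikov₂ τ₁ τ₂ = -(3 / (2 * P.a)) * solv (P.inhom τ₁ τ₂ P.qJet).2 := by
  rw [melnikov₂, ← integral_add_right_eq_self _ τ₂, solv_apply]
  simp only [add_sub_cancel_right]
  rw [integral_ph_mul]
  congr 1
  refine integral_congr_ae (ae_of_all _ fun z => ?_)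
  simp only [inhom_snd, BoundedContinuousFunction.coe_add, Pi.add_apply, coupling_apply, qJet_trd,
    qJet_fst, qJet_snd, force_apply]
  rw [show z + τ₂ - τ₁ = z + -(τ₁ - τ₂) by ring,
    show z + -(τ₁ - τ₂) + P.p = z + (P.p - (τ₁ - τ₂)) by ring]
  ring

theorem melnikov₁_eq (τ₁ τ₂ : ℝ) :
    P.melnikov₁ τ₁ τ₂ = P.M₁₁ (τ₁ - τ₂) + P.M₁₂ * Real.cos (P.Ω * τ₁) := by
  rw [melnikov₁_eq_solv, inhom_fst, map_add, M₁₁_eq, M₁₂_eq, solv_force]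
  ring

theorem melnikov₂_eq (τ₁ τ₂ : ℝ) :
    P.melnikov₂ τ₁ τ₂ = P.M₂₁ (τ₁ - τ₂) + P.M₁₂ * Real.cos (P.Ω * τ₂) := by
  rw [melnikov₂_eq_solv, inhom_snd, map_add, M₂₁_eq, M₁₂_eq, solv_force]
  ring

/-- The derivative of `M₁₁`. -/
def dM₁₁ (η : ℝ) : ℝ := -(3 / (2 * P.a)) * solv (P.coupling (η - P.p) η 0 (P.pJet, P.pJet))

/-- The derivative of `M₂₁`. -/
def dM₂₁ (η : ℝ) : ℝ := 3 / (2 * P.a) * solv (P.coupling (P.p - η) (-η) 0 (P.pJet, P.pJet))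

theorem hasDerivAt_M₁₁ (η : ℝ) : HasDerivAt P.M₁₁ (P.dM₁₁ η) η := by
  rw [funext P.M₁₁_eq]
  simp only [solv_coupling]
  have hs : HasDerivAt (fun η => η - P.p) 1 η := (hasDerivAt_id η).sub_const _
  have h1 := (hasDerivAt_solv_shift P.hasDerivAt_qJet_trd (η - P.p)).comp η hs
  have h2 := (hasDerivAt_solv_shift P.hasDerivAt_qJet_fst (η - P.p)).comp η hs
  have h3 := hasDerivAt_solv_shift P.hasDerivAt_qJet_trd η
  have h4 := hasDerivAt_solv_shift P.hasDerivAt_qJet_fst η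
  refine ((((((h1.const_mul (-P.lamM')).fun_sub (h3.const_mul P.lamM)).fun_sub
    (h2.const_mul P.lamE')).fun_sub (h4.const_mul P.lamE)).sub_const
    (P.γ * solv P.qJet.2.1)).const_mul (-(3 / (2 * P.a)))).congr_deriv ?_
  rw [dM₁₁, solv_coupling]
  ring

/-- The shifts `p - η` and `-η` both have derivative `-1`, whence the sign in `dM₂₁`; the gain term
does not depend on `η`. -/
theorem hasDerivAt_M₂₁ (η : ℝ) : HasDerivAt P.M₂₁ (P.dM₂₁ η) η := by
  rw [funext P.M₂₁_eq]
  simp only [solv_coupling]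
  have hs : HasDerivAt (fun η => P.p - η) (-1) η := (hasDerivAt_id η).const_sub _
  have h1 := (hasDerivAt_solv_shift P.hasDerivAt_qJet_trd (P.p - η)).comp η hs
  have h2 := (hasDerivAt_solv_shift P.hasDerivAt_qJet_fst (P.p - η)).comp η hs
  have h3 := (hasDerivAt_solv_shift P.hasDerivAt_qJet_trd (-η)).comp η (hasDerivAt_neg η)
  have h4 := (hasDerivAt_solv_shift P.hasDerivAt_qJet_fst (-η)).comp η (hasDerivAt_neg η)
  refine ((((((h1.const_mul (-P.lamM')).fun_sub (h3.const_mul P.lamM)).fun_sub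
    (h2.const_mul P.lamE')).fun_sub (h4.const_mul P.lamE)).sub_const
    (-P.γ * solv P.qJet.2.1)).const_mul (-(3 / (2 * P.a)))).congr_deriv ?_
  rw [dM₂₁, solv_coupling]
  ring

theorem hasDerivAt_cos_mul (ω τ : ℝ) :
    HasDerivAt (fun τ => Real.cos (ω * τ)) (-(ω * Real.sin (ω * τ))) τ :=
  (((hasDerivAt_id τ).const_mul ω).cos).congr_deriv (by simp; ring)

/-- The derivative of the pair of Melnikov functions. -/
def dMelnikov (τ₁ τ₂ : ℝ) : (ℝ × ℝ) →L[ℝ] (ℝ × ℝ) :=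
  let x : (ℝ × ℝ) →L[ℝ] ℝ := .fst ℝ ℝ ℝ
  let y : (ℝ × ℝ) →L[ℝ] ℝ := .snd ℝ ℝ ℝ
  (P.dM₁₁ (τ₁ - τ₂) • (x - y) + (P.M₁₂ * -(P.Ω * Real.sin (P.Ω * τ₁))) • x).prod
    (P.dM₂₁ (τ₁ - τ₂) • (x - y) + (P.M₁₂ * -(P.Ω * Real.sin (P.Ω * τ₂))) • y)

theorem dMelnikov_apply (τ₁ τ₂ : ℝ) (α : ℝ × ℝ) : P.dMelnikov τ₁ τ₂ α =
    (P.dM₁₁ (τ₁ - τ₂) * (α.1 - α.2) + P.M₁₂ * -(P.Ω * Real.sin (P.Ω * τ₁)) * α.1,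
      P.dM₂₁ (τ₁ - τ₂) * (α.1 - α.2) + P.M₁₂ * -(P.Ω * Real.sin (P.Ω * τ₂)) * α.2) := rfl

theorem hasFDerivAt_melnikov (τ₁ τ₂ : ℝ) :
    HasFDerivAt (fun τ : ℝ × ℝ => (P.melnikov₁ τ.1 τ.2, P.melnikov₂ τ.1 τ.2))
      (P.dMelnikov τ₁ τ₂) (τ₁, τ₂) := by
  simp only [melnikov₁_eq, melnikov₂_eq]
  have hx : HasFDerivAt (fun τ : ℝ × ℝ => τ.1) (.fst ℝ ℝ ℝ) (τ₁, τ₂) := hasFDerivAt_fst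
  have hy : HasFDerivAt (fun τ : ℝ × ℝ => τ.2) (.snd ℝ ℝ ℝ) (τ₁, τ₂) := hasFDerivAt_snd
  have h1 := (P.hasDerivAt_M₁₁ (τ₁ - τ₂)).comp_hasFDerivAt (τ₁, τ₂) (hx.fun_sub hy)
  have h2 := (P.hasDerivAt_M₂₁ (τ₁ - τ₂)).comp_hasFDerivAt (τ₁, τ₂) (hx.fun_sub hy)
  have h3 := ((hasDerivAt_cos_mul P.Ω τ₁).const_mul P.M₁₂).comp_hasFDerivAt (τ₁, τ₂) hx
  have h4 := ((hasDerivAt_cos_mul P.Ω τ₂).const_mul P.M₁₂).comp_hasFDerivAt (τ₁, τ₂) hy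
  exact (h1.fun_add h3).prodMk (h2.fun_add h4)

/-! ### Kernel amplitudes and the Jacobian of the Melnikov functions -/

variable {P}

/-- The damping term drops out since `∫ st st' = 0`; only the amplitude of the other component
remains. -/
theorem solv_coupling_smul_pJet (b η g : ℝ) (α α' : ℝ) :
    solv (P.coupling b η g (α • P.pJet, α' • P.pJet)) =
      α' * solv (P.coupling b η 0 (P.pJet, P.pJet)) := by
  have : solv P.pJet.2.1 = 0 := by
    have h : P.pJet.2.1 = (-(3 / (2 * P.a))) • jetST.2.1 := rfl
    rw [h, map_smul, solv_jetST_snd, smul_zero]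
  simp only [solv_coupling, Prod.smul_fst, Prod.smul_snd, map_smul, this, smul_eq_mul]
  ring

variable (P) in
/-- The derivative of the forcing term. -/
def forceDeriv (τ : ℝ) : BC :=
  BoundedContinuousFunction.ofNormedAddCommGroup (fun z => P.Ω * Real.cos (P.Ω * (z + τ)))
    (by fun_prop) |P.Ω| fun z => by
      rw [norm_mul]
      exact mul_le_of_le_one_right (abs_nonneg _) (Real.abs_cos_le_one _)

theorem solv_forceDeriv (τ : ℝ) :
    solv (P.forceDeriv τ) = P.Ω * (-P.sineAmp * Real.sin (P.Ω * τ)) := by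
  rw [sineAmp, ← integral_st_mul_cos_add, ← integral_const_mul]
  exact integral_congr_ae (ae_of_all _ fun z => mul_left_comm _ _ _)

/-- Moving the derivative off `st` puts it on the inhomogeneity, where it produces the shift
derivatives of the Melnikov integrals. -/
theorem integral_deriv_st_mul_coupling (b η g τ : ℝ) :
    ∫ z, jetST.2.1 z * (P.coupling b η g (P.qJet, P.qJet) + P.force τ) z =
      -solv (P.coupling b η 0 (P.pJet, P.pJet)) + P.Ω * P.sineAmp * Real.sin (P.Ω * τ) := by
  let F : BC := P.coupling b η g (P.pJet, P.pJet) + P.forceDeriv τ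
  have hd : ∀ z, HasDerivAt (P.coupling b η g (P.qJet, P.qJet) + P.force τ) (F z) z := by
    intro z
    have h1 := (P.hasDerivAt_qJet_trd (z + b)).comp z ((hasDerivAt_id z).add_const b)
    have h2 := (P.hasDerivAt_qJet_trd (z + η)).comp z ((hasDerivAt_id z).add_const η)
    have h3 := (P.hasDerivAt_qJet_fst (z + b)).comp z ((hasDerivAt_id z).add_const b)
    have h4 := (P.hasDerivAt_qJet_fst (z + η)).comp z ((hasDerivAt_id z).add_const η)
    have h5 := P.isJet_qJet.deriv₂ z
    have h6 := (((hasDerivAt_id z).add_const τ).const_mul P.Ω).sin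
    refine ((((((h1.const_mul (-P.lamM')).fun_sub (h2.const_mul P.lamM)).fun_sub
      (h3.const_mul P.lamE')).fun_sub (h4.const_mul P.lamE)).fun_sub
      (h5.const_mul g)).fun_add h6).congr_deriv ?_
    have hF : F z = P.coupling b η g (P.pJet, P.pJet) z + P.Ω * Real.cos (P.Ω * (z + τ)) := rfl
    rw [hF, coupling_apply]
    have : P.qJet.2.2 z = P.pJet.2.1 z := rfl
    simp only [this, id]
    ring
  rw [integral_deriv_st_mul hd, map_add]
  have h1 := solv_coupling_smul_pJet (P := P) b η g 1 1
  rw [one_smul, one_mul] at h1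
  rw [h1, solv_forceDeriv]
  ring

theorem solv_mul_self_add (X : Jet) (α c : ℝ) :
    solv ((X + α • c • jetST).1 * (X + α • c • jetST).1) =
      solv (X.1 * X.1) + 2 * (α * c) * ∫ z, st z * (st z * X.1 z) := by
  have e : (X + α • c • jetST).1 * (X + α • c • jetST).1 =
      X.1 * X.1 + (2 * (α * c)) • (jetST.1 * X.1) + (α * c) ^ 2 • (jetST.1 * jetST.1) := by
    ext z
    simp only [Prod.fst_add, Prod.smul_fst, BoundedContinuousFunction.coe_mul, Pi.mul_apply,
      BoundedContinuousFunction.coe_add, Pi.add_apply, BoundedContinuousFunction.coe_smul,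
      smul_eq_mul]
    ring
  have h3 : solv (jetST.1 * jetST.1) = 0 := integral_st_cube
  rw [e, map_add, map_add, map_smul, map_smul, h3, smul_zero, add_zero]
  rfl

/-- The coupling contributes the `α'` term directly. The cross term of the square is `3α ∫ st² X`,
which Green's identity equates with `α ∫ st' N`; this supplies the `-α` term and the forcing term.
So the unknown `X` disappears from the increment, and a row of the Jacobian is left. -/
theorem solv_remainder_component (ha : P.a ≠ 0) (b η g τ : ℝ) {X : Jet} (Y : Jet) (hX : IsJet X)
    (hN : ∀ z, linOp X z = (P.coupling b η g (P.qJet, P.qJet) + P.force τ) z) (α α' : ℝ) :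
    solv (P.coupling b η g (X + α • P.pJet, Y + α' • P.pJet)
        - P.a • ((X + α • P.pJet).1 * (X + α • P.pJet).1)) =
      solv (P.coupling b η g (X, Y) - P.a • (X.1 * X.1)) +
        ((α' - α) * solv (P.coupling b η 0 (P.pJet, P.pJet)) +
          α * (P.Ω * P.sineAmp * Real.sin (P.Ω * τ))) := by
  have h1 := integral_deriv_st_mul_linOp hX hN
  rw [integral_deriv_st_mul_coupling] at h1
  have h2 := solv_mul_self_add X α (-(3 / (2 * P.a)))
  have h3 : P.coupling b η g (X + α • P.pJet, Y + α' • P.pJet) =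
      P.coupling b η g (X, Y) + P.coupling b η g (α • P.pJet, α' • P.pJet) := by
    rw [← map_add]; rfl
  rw [h3, map_sub, map_add, solv_coupling_smul_pJet, map_smul]
  simp only [pJet] at h2 h1 ⊢
  rw [h2, map_sub, map_smul, smul_eq_mul, smul_eq_mul]
  have h4 : P.a * (2 * (α * -(3 / (2 * P.a)))) = -3 * α := by field_simp
  linear_combination (-(∫ z, st z * (st z * X.1 z))) * h4 + (-α) * h1

theorem remainder_fst (η : ℝ) (X Y : Jet) : (P.remainder η (X, Y)).1 =
    P.coupling (η - P.p) η P.γ (X, Y) - P.a • (X.1 * X.1) := rfl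

theorem remainder_snd (η : ℝ) (X Y : Jet) : (P.remainder η (X, Y)).2 =
    P.coupling (P.p - η) (-η) (-P.γ) (Y, X) - P.a • (Y.1 * Y.1) := rfl

/-- Every simple zero of the pair of Melnikov functions gives a persisting homoclinic orbit. -/
theorem IsSimpleMelnikovZero.persists (ha : P.a ≠ 0) (hβ : P.β = 0) (hΩ : P.Ω ≠ 0) {τ₁ τ₂ : ℝ}
    (h : P.IsSimpleMelnikovZero τ₁ τ₂) : P.Persists τ₁ τ₂ := by
  obtain ⟨h₁, h₂, L, hL⟩ := h
  have hκ : -(3 / (2 * P.a)) ≠ 0 := neg_ne_zero.2 (by positivity)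
  rw [melnikov₁_eq_solv] at h₁
  rw [melnikov₂_eq_solv] at h₂
  have hLd : (L : (ℝ × ℝ) →L[ℝ] (ℝ × ℝ)) = P.dMelnikov τ₁ τ₂ :=
    hL.unique (P.hasFDerivAt_melnikov τ₁ τ₂)
  -- The inverse, up to sign, of the factor `-(3 / (2a))` relating `ph` to `st`; the leftover sign
  -- is that of the coupling increment `α' - α`.
  let u : ℝˣ := Units.mk0 (2 * P.a / 3) (by positivity)
  let A : (ℝ × ℝ) ≃L[ℝ] (ℝ × ℝ) := L.trans (ContinuousLinearEquiv.smulLeft u)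
  have hA : ∀ α, A α = (2 * P.a / 3) • P.dMelnikov τ₁ τ₂ α := fun α => by
    rw [← hLd]; rfl
  refine persists_of_nondegenerate ha hβ hΩ τ₁ τ₂ ((mul_eq_zero.1 h₁).resolve_left hκ)
    ((mul_eq_zero.1 h₂).resolve_left hκ) A fun X Y hX hY eX eY α => ?_
  simp only [inhom_fst] at eX
  simp only [inhom_snd] at eY
  have r1 := solv_remainder_component ha (τ₁ - τ₂ - P.p) (τ₁ - τ₂) P.γ τ₁ Y hX eX α.1 α.2
  have r2 := solv_remainder_component ha (P.p - (τ₁ - τ₂)) (-(τ₁ - τ₂)) (-P.γ) τ₂ X hY eY α.2 α.1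
  rw [hA, dMelnikov_apply]
  change (solv (P.remainder (τ₁ - τ₂) (X + α.1 • P.pJet, Y + α.2 • P.pJet)).1,
    solv (P.remainder (τ₁ - τ₂) (X + α.1 • P.pJet, Y + α.2 • P.pJet)).2) = _
  rw [remainder_fst, remainder_snd, remainder_fst, remainder_snd, r1, r2, Prod.smul_mk,
    Prod.mk_add_mk, dM₁₁, dM₂₁, M₁₂_eq, smul_eq_mul, smul_eq_mul]
  refine Prod.ext (congrArg₂ _ rfl ?_) (congrArg₂ _ rfl ?_)
  · field_simp
    ring
  · field_simp

end PTParams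

/-! ### The Fourier transform of the soliton profile -/

theorem sigmoid_mul_sigmoid_neg (z : ℝ) : z.sigmoid * (1 - z.sigmoid) = sc z / 4 := by
  have h1 : Real.exp z = Real.exp (z / 2) * Real.exp (z / 2) := by
    rw [← Real.exp_add]; ring_nf
  have h2 : Real.exp (-(z / 2)) = (Real.exp (z / 2))⁻¹ := Real.exp_neg _
  have h3 : Real.exp (-z) = (Real.exp z)⁻¹ := Real.exp_neg _
  have h0 := Real.exp_pos (z / 2)
  rw [Real.sigmoid_def, sc, Real.cosh_eq, h2, h3, h1]
  field_simp
  ring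

theorem log_one_sub_sigmoid (z : ℝ) : Real.log (1 - z.sigmoid) = Real.log z.sigmoid - z := by
  rw [← Real.sigmoid_neg, ← Real.sigmoid_mul_rexp_neg, Real.log_mul (Real.sigmoid_pos z).ne'
    (Real.exp_pos _).ne', Real.log_exp]
  ring

/-- As `log σ - log (1 - σ) = z`, the Beta integrand becomes a pure oscillation. The exponents are
left in the unsimplified form of `Complex.betaIntegral`. -/
theorem sigmoid_cpow_mul (ω z : ℝ) :
    (z.sigmoid : ℂ) ^ (1 + ω * Complex.I - 1) * (1 - (z.sigmoid : ℂ)) ^ (1 - ω * Complex.I - 1) =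
      Complex.exp (ω * z * Complex.I) := by
  have h1 := Real.sigmoid_pos z
  have h2 : 0 < 1 - z.sigmoid := sub_pos.2 (Real.sigmoid_lt_one z)
  have e : (1 - (z.sigmoid : ℂ)) = ((1 - z.sigmoid : ℝ) : ℂ) := by push_cast; rfl
  rw [e, Complex.cpow_def_of_ne_zero (by exact_mod_cast h1.ne'),
    Complex.cpow_def_of_ne_zero (by exact_mod_cast h2.ne'), ← Complex.exp_add,
    ← Complex.ofReal_log h1.le, ← Complex.ofReal_log h2.le, log_one_sub_sigmoid]
  congr 1
  push_cast
  ring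

/-- The substitution `t = sigmoid z`, with Jacobian `sc z / 4`, identifies the integral with `B(1 +
iω, 1 - iω) = Γ(1 + iω) Γ(1 - iω)`. The reflection formula evaluates it. -/
theorem integral_sc_mul_exp {ω : ℝ} (hω : ω ≠ 0) :
    ∫ z : ℝ, ((sc z / 4 : ℝ) : ℂ) * Complex.exp (ω * z * Complex.I) =
      ((Real.pi * ω / Real.sinh (Real.pi * ω) : ℝ) : ℂ) := by
  have hb : Complex.betaIntegral (1 + ω * Complex.I) (1 - ω * Complex.I) =
      ∫ z : ℝ, ((sc z / 4 : ℝ) : ℂ) * Complex.exp (ω * z * Complex.I) := by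
    rw [Complex.betaIntegral, intervalIntegral.integral_of_le zero_le_one,
      integral_Ioc_eq_integral_Ioo, ← Real.range_sigmoid, ← image_univ,
      integral_image_eq_integral_abs_deriv_smul MeasurableSet.univ
        (fun x _ => (Real.hasDerivAt_sigmoid x).hasDerivWithinAt)
        Real.sigmoid_injective.injOn, setIntegral_univ]
    refine integral_congr_ae (ae_of_all _ fun z => ?_)
    simp only
    rw [sigmoid_cpow_mul, sigmoid_mul_sigmoid_neg, abs_of_pos (by have := sc_pos z; positivity),
      Complex.real_smul]
  rw [← hb, Complex.betaIntegral_eq_Gamma_mul_div _ _ (by simp) (by simp)]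
  have hI : (ω * Complex.I : ℂ) ≠ 0 := by simp [hω]
  rw [add_comm (1 : ℂ) (ω * Complex.I), Complex.Gamma_add_one _ hI, mul_assoc,
    Complex.Gamma_mul_Gamma_one_sub, show (ω * Complex.I + 1 + (1 - ω * Complex.I) : ℂ) = 2 by ring,
    show (2 : ℂ) = 1 + 1 by norm_num, Complex.Gamma_add_one 1 one_ne_zero, Complex.Gamma_one, ← mul_assoc (Real.pi : ℂ), Complex.sin_mul_I]
  have hs : Complex.sinh (Real.pi * ω) ≠ 0 := by
    rw [← Complex.ofReal_mul, ← Complex.ofReal_sinh]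
    exact_mod_cast Real.sinh_ne_zero.2 (mul_ne_zero Real.pi_ne_zero hω)
  have hI := Complex.I_ne_zero
  push_cast
  field_simp

theorem integral_sc_mul_cos {ω : ℝ} (hω : ω ≠ 0) :
    ∫ z : ℝ, sc z * Real.cos (ω * z) = 4 * (Real.pi * ω / Real.sinh (Real.pi * ω)) := by
  have h := congrArg Complex.re (integral_sc_mul_exp hω)
  have hi : Integrable fun z : ℝ => ((sc z / 4 : ℝ) : ℂ) * Complex.exp (ω * z * Complex.I) := by
    refine (integrable_sc.div_const 4).ofReal.mul_bdd (c := 1) (by fun_prop)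
      (ae_of_all _ fun z => ?_)
    rw [← Complex.ofReal_mul, Complex.norm_exp_ofReal_mul_I]
  rw [Complex.ofReal_re] at h
  have h2 : ∫ z : ℝ, (((sc z / 4 : ℝ) : ℂ) * Complex.exp (ω * z * Complex.I)).re =
    (∫ z : ℝ, ((sc z / 4 : ℝ) : ℂ) * Complex.exp (ω * z * Complex.I)).re := integral_re hi
  rw [← h2] at h
  rw [← h, ← integral_const_mul]
  refine integral_congr_ae (ae_of_all _ fun z => ?_)
  simp only
  rw [Complex.re_ofReal_mul, ← Complex.ofReal_mul, Complex.exp_ofReal_mul_I_re]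
  ring

/-- Integration by parts with `st = -sc'` reduces to the cosine transform of `sc`. -/
theorem integral_st_mul_sin {ω : ℝ} (hω : ω ≠ 0) :
    ∫ z : ℝ, st z * Real.sin (ω * z) = 4 * Real.pi * ω ^ 2 / Real.sinh (ω * Real.pi) := by
  have hi : Integrable fun z => sc z * (ω * Real.cos (ω * z)) :=
    integrable_sc_mul (C := |ω|) (by fun_prop) fun z => by
      rw [abs_mul]
      exact mul_le_of_le_one_right (abs_nonneg _) (Real.abs_cos_le_one _)
  have hi' : Integrable fun z => sc z * Real.sin (ω * z) :=
    integrable_sc_mul (by fun_prop) fun z => Real.abs_sin_le_one _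
  have hj : Integrable fun z => -(sc z * th z) * Real.sin (ω * z) := by
    simpa [st] using (integrable_st_mul_sin ω).neg
  have h := integral_mul_deriv_eq_deriv_mul_of_integrable (u := sc)
    (v := fun z => Real.sin (ω * z)) (u' := fun z => -(sc z * th z))
    (v' := fun z => ω * Real.cos (ω * z)) (fun z _ => hasDerivAt_sc z)
    (fun z _ => (((hasDerivAt_id z).const_mul ω).sin).congr_deriv (by simp; ring)) hi hj hi'
  simp only [neg_mul, integral_neg, neg_neg] at h
  have h2 : ∫ z, st z * Real.sin (ω * z) = ∫ z, sc z * (ω * Real.cos (ω * z)) := h.symm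
  rw [h2]
  have h3 : ∫ z, sc z * (ω * Real.cos (ω * z)) = ω * ∫ z, sc z * Real.cos (ω * z) := by
    rw [← integral_const_mul]
    exact integral_congr_ae (ae_of_all _ fun z => mul_left_comm _ _ _)
  rw [h3, integral_sc_mul_cos hω, mul_comm Real.pi ω]
  ring

/-! ### Damping against forcing amplitude -/

namespace PTParams

variable (P : PTParams)

/-- The damping part of the Melnikov functions. -/
def damp : ℝ := P.γ * ∫ z, P.ph z * P.ph z

theorem damp_eq : P.damp = P.γ * ((3 / (2 * P.a)) ^ 2 * (8 / 15)) := by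
  have : ∫ z, st z * P.ph z = -(3 / (2 * P.a)) * (8 / 15) := by
    rw [← integral_st_sq, ← integral_const_mul]
    exact integral_congr_ae (ae_of_all _ fun z => by simp only [ph_eq]; ring)
  rw [damp, integral_ph_mul, this]
  ring

variable {P}

/-- At `Ω = 0` the hypothesis reads `0 < 0`. -/
theorem Ω_ne_zero (h : P.γ * |Real.sinh (P.Ω * Real.pi)| < -5 * P.a * P.Ω ^ 2 * Real.pi) :
    P.Ω ≠ 0 := by
  rintro h0
  simp [h0] at h

theorem damp_pos (ha : P.a < 0) (hγ : 0 < P.γ) : 0 < P.damp := by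
  rw [damp_eq]
  have : 3 / (2 * P.a) ≠ 0 := by have := ha.ne; positivity
  positivity

/-- Here `damp = 6γ/(5a²)` and `|M₁₂| = 6πΩ²/(|a| |sinh Ωπ|)`, so the claim is the hypothesis
multiplied by `6/(5a²)` and divided by `|sinh Ωπ|`. -/
theorem damp_lt (ha : P.a < 0)
    (h : P.γ * |Real.sinh (P.Ω * Real.pi)| < -5 * P.a * P.Ω ^ 2 * Real.pi) :
    P.damp < |P.M₁₂| := by
  have hΩ := Ω_ne_zero h
  have hs : 0 < |Real.sinh (P.Ω * Real.pi)| :=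
    abs_pos.2 (Real.sinh_ne_zero.2 (mul_ne_zero hΩ Real.pi_ne_zero))
  rw [M₁₂_eq, sineAmp, integral_st_mul_sin hΩ, damp_eq, abs_mul, abs_div,
    abs_of_pos (show 0 < 4 * Real.pi * P.Ω ^ 2 by positivity), abs_of_pos
    (show 0 < -(3 / (2 * P.a)) from neg_pos.2 (div_neg_of_pos_of_neg (by norm_num) (by linarith)))]
  have ha' : 0 < -P.a := by linarith
  obtain ⟨b, hb⟩ : ∃ b, b = -P.a := ⟨_, rfl⟩
  have hab : P.a = -b := by linarith
  rw [← hb] at ha'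
  rw [hab] at h ⊢
  rw [← mul_div_assoc (-(3 / (2 * -b))), lt_div_iff₀ hs]
  have e1 : P.γ * ((3 / (2 * -b)) ^ 2 * (8 / 15)) * |Real.sinh (P.Ω * Real.pi)| =
      P.γ * |Real.sinh (P.Ω * Real.pi)| * (6 / (5 * b ^ 2)) := by field_simp; ring
  have e2 : -(3 / (2 * -b)) * (4 * Real.pi * P.Ω ^ 2) =
      (-5 * -b * P.Ω ^ 2 * Real.pi) * (6 / (5 * b ^ 2)) := by field_simp; ring
  rw [e1, e2]
  exact mul_lt_mul_of_pos_right h (by positivity)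

end PTParams

/-! ### The reduced function -/

/-- The reduced function in terms of its ingredients. -/
def redF (m A B θ : ℝ) : ℝ :=
  B ^ 2 * m ^ 2 * Real.sin θ ^ 2 + (A * m - m * B * Real.cos θ) ^ 2
    - m ^ 2 * m ^ 2 * Real.sin θ ^ 2

/-- The derivative of the reduced function in terms of its ingredients. -/
def redD (m W A B A' B' θ : ℝ) : ℝ :=
  2 * m ^ 2 * (B * B' * Real.sin θ ^ 2 + B ^ 2 * W * Real.sin θ * Real.cos θ
    + (A - B * Real.cos θ) * (A' - B' * Real.cos θ + B * W * Real.sin θ)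
    - m ^ 2 * W * Real.sin θ * Real.cos θ)

theorem exists_cos_sin_eq {c s : ℝ} (h : s ^ 2 + c ^ 2 = 1) :
    ∃ θ, Real.cos θ = c ∧ Real.sin θ = s := by
  have hc : c ^ 2 ≤ 1 := by nlinarith [sq_nonneg s]
  have hc' := abs_le.1 ((sq_le_one_iff_abs_le_one c).1 hc)
  have e : 1 - c ^ 2 = s ^ 2 := by linarith
  rcases le_total 0 s with hs | hs
  · refine ⟨Real.arccos c, Real.cos_arccos hc'.1 hc'.2, ?_⟩
    rw [Real.sin_arccos, e, Real.sqrt_sq hs]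
  · refine ⟨-Real.arccos c, ?_, ?_⟩
    · rw [Real.cos_neg, Real.cos_arccos hc'.1 hc'.2]
    · rw [Real.sin_neg, Real.sin_arccos, e, Real.sqrt_sq_eq_abs, abs_of_nonpos hs, neg_neg]

theorem exists_equiv_of_injective (D : (ℝ × ℝ) →L[ℝ] (ℝ × ℝ)) (hD : Function.Injective D) :
    ∃ L : (ℝ × ℝ) ≃L[ℝ] (ℝ × ℝ), (L : (ℝ × ℝ) →L[ℝ] (ℝ × ℝ)) = D :=
  ⟨(LinearEquiv.ofInjectiveEndo (D : (ℝ × ℝ) →ₗ[ℝ] (ℝ × ℝ)) hD).toContinuousLinearEquiv, by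
    ext <;> rfl⟩

namespace PTParams

variable {P : PTParams}

/-- The reduced function is even in the frequency, which later permits `W = |Ω| > 0`. -/
theorem reduced_eq {W : ℝ} (hW : W = P.Ω ∨ W = -P.Ω) (η : ℝ) :
    P.reduced η = redF P.M₁₂ (P.M₁₁ η) (P.M₂₁ η) (W * η) := by
  rw [reduced, redF, M₂₂_eq]
  rcases hW with rfl | rfl
  · rfl
  · rw [neg_mul, Real.sin_neg, Real.cos_neg, neg_sq]

theorem hasDerivAt_reduced {W : ℝ} (hW : W = P.Ω ∨ W = -P.Ω) (η : ℝ) :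
    HasDerivAt P.reduced (redD P.M₁₂ W (P.M₁₁ η) (P.M₂₁ η) (P.dM₁₁ η) (P.dM₂₁ η) (W * η)) η := by
  rw [funext (reduced_eq hW)]
  unfold redF redD
  have hA := P.hasDerivAt_M₁₁ η
  have hB := P.hasDerivAt_M₂₁ η
  have hC := hasDerivAt_cos_mul W η
  have hS : HasDerivAt (fun η => Real.sin (W * η)) (W * Real.cos (W * η)) η :=
    (((hasDerivAt_id η).const_mul W).sin).congr_deriv (by simp; ring)
  refine (((((hB.fun_pow 2).mul_const _).fun_mul (hS.fun_pow 2)).fun_add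
    (((hA.mul_const P.M₁₂).fun_sub ((hB.const_mul P.M₁₂).fun_mul hC)).fun_pow 2)).fun_sub
    ((hS.fun_pow 2).const_mul _)).congr_deriv ?_
  push_cast
  ring

/-- Simple zeros of the reduced function give simple zeros of the Melnikov functions. -/
theorem IsSimpleReducedZero.exists_isSimpleMelnikovZero (hΩ : P.Ω ≠ 0) {η : ℝ}
    (h : P.IsSimpleReducedZero η) : ∃ τ₂ : ℝ, P.IsSimpleMelnikovZero (η + τ₂) τ₂ := by
  obtain ⟨h0, -, h1⟩ := h
  rw [(hasDerivAt_reduced (Or.inl rfl) η).deriv] at h1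
  rw [reduced_eq (Or.inl rfl)] at h0
  have hCS := Real.sin_sq_add_cos_sq (P.Ω * η)
  set m := P.M₁₂ with hm
  set A := P.M₁₁ η with hA
  set B := P.M₂₁ η with hB
  set A' := P.dM₁₁ η with hA'
  set B' := P.dM₂₁ η with hB'
  unfold redF at h0
  unfold redD at h1
  have hm0 : m ≠ 0 := by
    rintro hm0
    exact h1 (by rw [hm0]; ring)
  -- If the sine vanished, `M = 0` would force `A = B cos Ωη`, and then `M'` would vanish too,
  -- against simplicity.
  have hS0 : Real.sin (P.Ω * η) ≠ 0 := by
    intro hS0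
    rw [hS0] at h0 h1
    have : (A - B * Real.cos (P.Ω * η)) = 0 := by
      have h2 : (A * m - m * B * Real.cos (P.Ω * η)) ^ 2 = 0 := by linarith
      have h3 := pow_eq_zero_iff (two_ne_zero) |>.1 h2
      have h4 : m * (A - B * Real.cos (P.Ω * η)) = 0 := by linarith
      exact (mul_eq_zero.1 h4).resolve_left hm0
    rw [this] at h1
    exact h1 (by ring)
  -- `M₂ = 0` prescribes `cos Ωτ₂`, and then `M₁ = 0` prescribes `sin Ωτ₂`. That these lie on the
  -- unit circle is the equation `M = 0`.
  obtain ⟨θ, hc, hs⟩ := exists_cos_sin_eq (c := -B / m)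
    (s := (A - B * Real.cos (P.Ω * η)) / (m * Real.sin (P.Ω * η))) (by
      field_simp
      have h5 : m ^ 2 * ((A - B * Real.cos (P.Ω * η)) ^ 2 + B ^ 2 * Real.sin (P.Ω * η) ^ 2 -
        m ^ 2 * Real.sin (P.Ω * η) ^ 2) = 0 := by linear_combination h0
      have := (mul_eq_zero.1 h5).resolve_left (pow_ne_zero 2 hm0)
      linear_combination this)
  have hBe : B = -m * Real.cos θ := by rw [hc]; field_simp
  have hAe : A = B * Real.cos (P.Ω * η) + m * Real.sin (P.Ω * η) * Real.sin θ := by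
    rw [hs]; field_simp; ring
  have hθ := Real.sin_sq_add_cos_sq θ
  have e2 : P.Ω * (θ / P.Ω) = θ := mul_div_cancel₀ _ hΩ
  have e1 : P.Ω * (η + θ / P.Ω) = P.Ω * η + θ := by rw [mul_add, e2]
  have e3 : η + θ / P.Ω - θ / P.Ω = η := by ring
  refine ⟨θ / P.Ω, ?_, ?_, ?_⟩
  · rw [melnikov₁_eq, e1, e3, Real.cos_add, ← hA, ← hm]
    linear_combination hAe + Real.cos (P.Ω * η) * hBe
  · rw [melnikov₂_eq, e2, e3, ← hB, ← hm]
    linear_combination hBe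
  · set D := P.dMelnikov (η + θ / P.Ω) (θ / P.Ω) with hD
    set y := m * -(P.Ω * Real.sin θ) with hy
    set x := m * -(P.Ω * Real.sin (P.Ω * η + θ)) with hx
    -- This is the Jacobian determinant, and `Ω M' = -2 m² sin(Ωη)` times it.
    have hdet : A' * y - x * B' + x * y ≠ 0 := by
      intro hdet
      refine h1 ?_
      have hx' : x = m * -(P.Ω * (Real.sin (P.Ω * η) * Real.cos θ +
        Real.cos (P.Ω * η) * Real.sin θ)) := by rw [hx, Real.sin_add]
      rw [hx', hy] at hdet
      have h6 : P.Ω * (2 * m ^ 2 * (B * B' * Real.sin (P.Ω * η) ^ 2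
          + B ^ 2 * P.Ω * Real.sin (P.Ω * η) * Real.cos (P.Ω * η)
          + (A - B * Real.cos (P.Ω * η)) *
            (A' - B' * Real.cos (P.Ω * η) + B * P.Ω * Real.sin (P.Ω * η))
          - m ^ 2 * P.Ω * Real.sin (P.Ω * η) * Real.cos (P.Ω * η))) = 0 := by
        have hAe' : A - B * Real.cos (P.Ω * η) = m * Real.sin (P.Ω * η) * Real.sin θ := by
          linarith
        rw [hAe', hBe]
        linear_combination (-2 * m ^ 2 * Real.sin (P.Ω * η)) * hdet +
          2 * m ^ 4 * P.Ω ^ 2 * Real.sin (P.Ω * η) * Real.cos (P.Ω * η) * hθ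
      exact (mul_eq_zero.1 h6).resolve_left hΩ
    have happ : ∀ α : ℝ × ℝ, D α = (A' * (α.1 - α.2) + x * α.1, B' * (α.1 - α.2) + y * α.2) :=
      fun α => by rw [hD, dMelnikov_apply, e1, e2, e3]
    have hinj : Function.Injective D := by
      rw [injective_iff_map_eq_zero]
      intro α hα
      rw [happ] at hα
      have hα1 : A' * (α.1 - α.2) + x * α.1 = 0 := congrArg Prod.fst hα
      have hα2 : B' * (α.1 - α.2) + y * α.2 = 0 := congrArg Prod.snd hα
      have u1 : (A' * y - x * B' + x * y) * α.1 = 0 := by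
        linear_combination (y - B') * hα1 + A' * hα2
      have u2 : (A' * y - x * B' + x * y) * α.2 = 0 := by
        linear_combination (-B') * hα1 + (A' + x) * hα2
      exact Prod.ext ((mul_eq_zero.1 u1).resolve_left hdet)
        ((mul_eq_zero.1 u2).resolve_left hdet)
    obtain ⟨L, hL⟩ := exists_equiv_of_injective D hinj
    exact ⟨L, by rw [hL]; exact P.hasFDerivAt_melnikov _ _⟩

/-! ### Behaviour at infinity -/

variable (P)

theorem solv_qJet_snd : solv P.qJet.2.1 = -(3 / (2 * P.a)) * (8 / 15) := by
  have h : P.qJet.2.1 = (-(3 / (2 * P.a))) • jetST.1 := rfl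
  have h2 : solv jetST.1 = 8 / 15 := integral_st_sq
  rw [h, map_smul, h2, smul_eq_mul]

theorem tendsto_add_cocompact (b : ℝ) : Tendsto (fun z => b + z) (cocompact ℝ) (cocompact ℝ) :=
  (Homeomorph.addLeft b).isClosedEmbedding.tendsto_cocompact

theorem tendsto_neg_cocompact : Tendsto (fun z : ℝ => -z) (cocompact ℝ) (cocompact ℝ) :=
  (Homeomorph.neg ℝ).isClosedEmbedding.tendsto_cocompact

theorem tendsto_sc_cocompact : Tendsto sc (cocompact ℝ) (𝓝 0) := by
  rw [cocompact_eq_atBot_atTop]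
  exact tendsto_sc_atBot.sup tendsto_sc_atTop

theorem tendsto_solv_coupling {b e : ℝ → ℝ}
    (hb : Tendsto b (cocompact ℝ) (cocompact ℝ)) (he : Tendsto e (cocompact ℝ) (cocompact ℝ))
    (g : ℝ) (X Y : Jet) {c d : ℝ} (hY : Tendsto Y.1 (cocompact ℝ) (𝓝 c))
    (hY' : Tendsto Y.2.2 (cocompact ℝ) (𝓝 d)) :
    Tendsto (fun η => solv (P.coupling (b η) (e η) g (X, Y))) (cocompact ℝ)
      (𝓝 (-g * solv X.2.1)) := by
  have : (cocompact ℝ).IsCountablyGenerated := by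
    rw [cocompact_eq_atBot_atTop]; infer_instance
  simp only [solv_coupling]
  have h1 := tendsto_solv_shift tendsto_add_cocompact hY
  have h2 := tendsto_solv_shift tendsto_add_cocompact hY'
  have := (((((h2.comp hb).const_mul (-P.lamM')).sub ((h2.comp he).const_mul P.lamM)).sub
    ((h1.comp hb).const_mul P.lamE')).sub ((h1.comp he).const_mul P.lamE)).sub_const
    (g * solv X.2.1)
  simpa using this

theorem tendsto_sc_mul_cocompact (g : BC) : Tendsto (fun z => sc z * g z) (cocompact ℝ) (𝓝 0) :=
  (bdd_le_mul_tendsto_zero' ‖g‖ (Eventually.of_forall g.abs_le)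
    tendsto_sc_cocompact).congr fun _ => mul_comm _ _

theorem tendsto_jetST_fst : Tendsto jetST.1 (cocompact ℝ) (𝓝 0) := tendsto_sc_mul_cocompact thB

theorem tendsto_jetST_snd : Tendsto jetST.2.1 (cocompact ℝ) (𝓝 0) :=
  (tendsto_sc_mul_cocompact ((1 / 2 : ℝ) • scB - thB * thB)).congr fun z => by
    simp [jetST]; ring

theorem tendsto_jetST_trd : Tendsto jetST.2.2 (cocompact ℝ) (𝓝 0) :=
  (tendsto_sc_mul_cocompact (thB - (3 : ℝ) • (scB * thB))).congr fun z => by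
    simp [jetST]; ring

/-- Only the damping and gain terms survive separation of the pulses. The filter `cocompact ℝ`
treats both ends at once. -/
theorem tendsto_coefficients :
    Tendsto (fun η => (P.M₁₁ η, P.M₂₁ η, P.dM₁₁ η, P.dM₂₁ η)) (cocompact ℝ)
      (𝓝 (-P.damp, P.damp, 0, 0)) := by
  have hq : Tendsto P.qJet.1 (cocompact ℝ) (𝓝 (-1 / P.a)) := by
    have := (tendsto_sc_cocompact.const_mul (3 / (2 * P.a))).const_add (-1 / P.a)
    simp only [mul_zero, add_zero] at this
    exact this
  have hq' : Tendsto P.qJet.2.2 (cocompact ℝ) (𝓝 (-(3 / (2 * P.a)) * 0)) :=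
    tendsto_jetST_snd.const_mul _
  have hp : Tendsto P.pJet.1 (cocompact ℝ) (𝓝 (-(3 / (2 * P.a)) * 0)) :=
    tendsto_jetST_fst.const_mul _
  have hp' : Tendsto P.pJet.2.2 (cocompact ℝ) (𝓝 (-(3 / (2 * P.a)) * 0)) :=
    tendsto_jetST_trd.const_mul _
  have hs : Tendsto (fun η => η - P.p) (cocompact ℝ) (cocompact ℝ) :=
    (tendsto_add_cocompact (-P.p)).congr fun z => by ring
  have hs' : Tendsto (fun η => P.p - η) (cocompact ℝ) (cocompact ℝ) :=
    ((tendsto_add_cocompact P.p).comp tendsto_neg_cocompact).congr fun z => by simp; ring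
  refine Tendsto.prodMk_nhds ?_ (Tendsto.prodMk_nhds ?_ (Tendsto.prodMk_nhds ?_ ?_))
  · have := (P.tendsto_solv_coupling hs tendsto_id P.γ P.qJet P.qJet hq hq').const_mul
      (-(3 / (2 * P.a)))
    rw [solv_qJet_snd] at this
    rw [funext P.M₁₁_eq, damp_eq]
    rw [show -(P.γ * ((3 / (2 * P.a)) ^ 2 * (8 / 15))) =
      -(3 / (2 * P.a)) * (-P.γ * (-(3 / (2 * P.a)) * (8 / 15))) by ring]
    exact this
  · have := (P.tendsto_solv_coupling hs' tendsto_neg_cocompact (-P.γ) P.qJet P.qJet hq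
      hq').const_mul (-(3 / (2 * P.a)))
    rw [solv_qJet_snd] at this
    rw [funext P.M₂₁_eq, damp_eq]
    rw [show P.γ * ((3 / (2 * P.a)) ^ 2 * (8 / 15)) =
      -(3 / (2 * P.a)) * (-(-P.γ) * (-(3 / (2 * P.a)) * (8 / 15))) by ring]
    exact this
  · have := (P.tendsto_solv_coupling hs tendsto_id 0 P.pJet P.pJet hp hp').const_mul
      (-(3 / (2 * P.a)))
    rw [neg_zero, zero_mul, mul_zero] at this
    exact this
  · have := (P.tendsto_solv_coupling hs' tendsto_neg_cocompact 0 P.pJet P.pJet hp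
      hp').const_mul (3 / (2 * P.a))
    rw [neg_zero, zero_mul, mul_zero] at this
    exact this

/-! ### Transversal zeros of the limit function and their survival -/

variable {P}

theorem redF_limit (m g θ : ℝ) : redF m (-g) g θ =
    m ^ 2 * ((1 + Real.cos θ) * (2 * g ^ 2 - m ^ 2 * (1 - Real.cos θ))) := by
  have h := Real.sin_sq θ
  unfold redF
  rw [h]; ring

theorem redD_limit (m W g θ : ℝ) : redD m W (-g) g 0 0 θ =
    -(2 * m ^ 2 * W * Real.sin θ * (g ^ 2 + m ^ 2 * Real.cos θ)) := by
  unfold redD; ring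

/-- A window of angles on which the limit of the reduced function has a transversal zero. -/
theorem exists_window {m g W : ℝ} (hg : 0 < g) (hgm : g < |m|) (hW : 0 < W) :
    ∃ x y : ℝ, x ≤ y ∧ 0 < redF m (-g) g x ∧ redF m (-g) g y < 0 ∧
      ∀ θ ∈ Icc x y, redD m W (-g) g 0 0 θ ≠ 0 := by
  have hm : 0 < m ^ 2 := by rw [← sq_abs]; have := hg.trans hgm; positivity
  set k := g ^ 2 / m ^ 2 with hk
  have hgk : g ^ 2 = k * m ^ 2 := (div_mul_cancel₀ _ hm.ne').symm
  have hk0 : 0 < k := by positivity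
  have hk1 : k < 1 := by
    rw [hk, div_lt_one hm, ← sq_abs m]
    exact pow_lt_pow_left₀ hgm hg.le two_ne_zero
  have hx : Real.cos (Real.arccos (1 - k)) = 1 - k :=
    Real.cos_arccos (by linarith) (by linarith)
  have hy : Real.cos (Real.arccos ((1 - 3 * k) / 2)) = (1 - 3 * k) / 2 :=
    Real.cos_arccos (by linarith) (by linarith)
  -- The zero is at `cos θ = 1 - 2k`. The left end takes the midpoint of `1` and `1 - 2k`; the right
  -- end takes the midpoint of `1 - 2k` and `-k`, which keeps `k + cos θ > 0` and so the derivative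
  -- away from zero. Both use `0 < k < 1`.
  refine ⟨Real.arccos (1 - k), Real.arccos ((1 - 3 * k) / 2),
    Real.arccos_le_arccos (by linarith), ?_, ?_, fun θ hθ => ?_⟩
  · rw [redF_limit, hx, hgk]
    have : (1 + (1 - k)) * (2 * (k * m ^ 2) - m ^ 2 * (1 - (1 - k))) = (2 - k) * (k * m ^ 2) := by
      ring
    rw [this]
    have : 0 < 2 - k := by linarith
    positivity
  · rw [redF_limit, hy, hgk]
    have : (1 + (1 - 3 * k) / 2) * (2 * (k * m ^ 2) - m ^ 2 * (1 - (1 - 3 * k) / 2)) =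
        -(3 / 4 * (1 - k) * ((1 - k) * m ^ 2)) := by ring
    rw [this, mul_neg, neg_lt_zero]
    have : 0 < 1 - k := by linarith
    positivity
  · have h0 : 0 < θ := lt_of_lt_of_le (Real.arccos_pos.2 (by linarith)) hθ.1
    have hπ : θ < Real.pi := lt_of_le_of_lt hθ.2
      (lt_of_le_of_ne (Real.arccos_le_pi _) fun h => by
        rw [Real.arccos_eq_pi] at h; linarith)
    have hs := Real.sin_pos_of_pos_of_lt_pi h0 hπ
    have hc : (1 - 3 * k) / 2 ≤ Real.cos θ := by
      rw [← hy]
      exact Real.cos_le_cos_of_nonneg_of_le_pi h0.le (Real.arccos_le_pi _) hθ.2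
    have hp : 0 < g ^ 2 + m ^ 2 * Real.cos θ := by
      rw [hgk]
      have : 0 < k + Real.cos θ := by linarith
      nlinarith
    rw [redD_limit]
    exact neg_ne_zero.2 (by positivity)

/-- Far out, the reduced function has a simple zero in each period. -/
theorem eventually_exists_simple_zero (ha : P.a < 0) (hγ : 0 < P.γ)
    (h : P.γ * |Real.sinh (P.Ω * Real.pi)| < -5 * P.a * P.Ω ^ 2 * Real.pi) :
    ∃ W x y : ℝ, 0 < W ∧ x ≤ y ∧ ∃ s : Set ℝ, s ∈ cocompact ℝ ∧ ∀ n : ℤ,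
      (∀ θ ∈ Icc x y, (θ + n * (2 * Real.pi)) / W ∈ s) →
      ∃ θ ∈ Icc x y, P.IsSimpleReducedZero ((θ + n * (2 * Real.pi)) / W) := by
  have hW0 : 0 < |P.Ω| := abs_pos.2 (Ω_ne_zero h)
  have hW := abs_choice P.Ω
  set W := |P.Ω|
  set m := P.M₁₂ with hm
  obtain ⟨x, y, hxy, hx, hy, hxyD⟩ := exists_window (damp_pos ha hγ) (damp_lt ha h) hW0
  refine ⟨W, x, y, hW0, hxy, ?_⟩
  have e1 : ∀ᶠ v : ℝ × ℝ × ℝ × ℝ in 𝓝 (-P.damp, P.damp, 0, 0), 0 < redF m v.1 v.2.1 x := by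
    have hc : Continuous fun v : ℝ × ℝ × ℝ × ℝ => redF m v.1 v.2.1 x := by
      unfold redF; fun_prop
    exact hc.continuousAt.eventually (lt_mem_nhds hx)
  have e2 : ∀ᶠ v : ℝ × ℝ × ℝ × ℝ in 𝓝 (-P.damp, P.damp, 0, 0), redF m v.1 v.2.1 y < 0 := by
    have hc : Continuous fun v : ℝ × ℝ × ℝ × ℝ => redF m v.1 v.2.1 y := by
      unfold redF; fun_prop
    exact hc.continuousAt.eventually (gt_mem_nhds hy)
  have e3 : ∀ᶠ v : ℝ × ℝ × ℝ × ℝ in 𝓝 (-P.damp, P.damp, 0, 0), ∀ θ ∈ Icc x y,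
      redD m W v.1 v.2.1 v.2.2.1 v.2.2.2 θ ≠ 0 := by
    -- Compactness of the window gives one neighbourhood of coefficients valid for all angles, so
    -- the derivative is nonzero wherever the intermediate value theorem locates the zero.
    refine isCompact_Icc.eventually_forall_of_forall_eventually fun θ hθ => ?_
    have hc : Continuous fun w : (ℝ × ℝ × ℝ × ℝ) × ℝ =>
        redD m W w.1.1 w.1.2.1 w.1.2.2.1 w.1.2.2.2 w.2 := by
      unfold redD; fun_prop
    exact hc.continuousAt.eventually_ne (hxyD θ hθ)
  refine ⟨_, P.tendsto_coefficients.eventually (e1.and (e2.and e3)), fun n hn => ?_⟩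
  simp only [mem_ofPred_eq] at hn
  have hred : ∀ θ, P.reduced ((θ + n * (2 * Real.pi)) / W) =
      redF m (P.M₁₁ ((θ + n * (2 * Real.pi)) / W)) (P.M₂₁ ((θ + n * (2 * Real.pi)) / W)) θ := by
    intro θ
    rw [reduced_eq hW, mul_div_cancel₀ _ hW0.ne']
    simp only [redF, Real.sin_add_int_mul_two_pi, Real.cos_add_int_mul_two_pi, hm]
  have hcont : Continuous fun θ => P.reduced ((θ + n * (2 * Real.pi)) / W) := by
    have : Continuous P.reduced :=
      continuous_iff_continuousAt.2 fun η => (hasDerivAt_reduced hW η).continuousAt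
    fun_prop
  have h1 := (hn x ⟨le_rfl, hxy⟩).1
  have h2 := (hn y ⟨hxy, le_rfl⟩).2.1
  rw [← hred] at h1 h2
  obtain ⟨θ, hθ, h0⟩ := intermediate_value_Icc' hxy hcont.continuousOn ⟨h2.le, h1.le⟩
  refine ⟨θ, hθ, h0, (hasDerivAt_reduced hW _).differentiableAt, ?_⟩
  have h3 := (hn θ hθ).2.2 θ hθ
  rw [(hasDerivAt_reduced hW _).deriv, mul_div_cancel₀ _ hW0.ne']
  simpa only [redD, Real.sin_add_int_mul_two_pi, Real.cos_add_int_mul_two_pi, hm] using h3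

theorem exists_simpleReducedZero_gt (ha : P.a < 0) (hγ : 0 < P.γ)
    (h : P.γ * |Real.sinh (P.Ω * Real.pi)| < -5 * P.a * P.Ω ^ 2 * Real.pi) (R : ℝ) :
    ∃ η > R, P.IsSimpleReducedZero η := by
  obtain ⟨W, x, y, hW, hxy, s, hs, hz⟩ := eventually_exists_simple_zero ha hγ h
  obtain ⟨Y, hY⟩ := mem_atTop_sets.1 (atTop_le_cocompact hs)
  -- Chosen so that even the left end of the translated window lies beyond `max Y R`.
  obtain ⟨n, hn⟩ := exists_int_gt ((W * (max Y R) - x) / (2 * Real.pi))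
  have hlt : ∀ θ ∈ Icc x y, max Y R < (θ + n * (2 * Real.pi)) / W := fun θ hθ => by
    rw [div_lt_iff₀ Real.two_pi_pos] at hn
    rw [lt_div_iff₀ hW]
    linarith [hθ.1]
  obtain ⟨θ, hθ, hη⟩ := hz n fun θ hθ => hY _ ((le_max_left _ _).trans (hlt θ hθ).le)
  exact ⟨_, (le_max_right Y R).trans_lt (hlt θ hθ), hη⟩

theorem exists_simpleReducedZero_lt (ha : P.a < 0) (hγ : 0 < P.γ)
    (h : P.γ * |Real.sinh (P.Ω * Real.pi)| < -5 * P.a * P.Ω ^ 2 * Real.pi) (R : ℝ) :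
    ∃ η < R, P.IsSimpleReducedZero η := by
  obtain ⟨W, x, y, hW, hxy, s, hs, hz⟩ := eventually_exists_simple_zero ha hγ h
  obtain ⟨Y, hY⟩ := mem_atBot_sets.1 (atBot_le_cocompact hs)
  obtain ⟨n, hn⟩ := exists_int_lt ((W * (min Y R) - y) / (2 * Real.pi))
  have hlt : ∀ θ ∈ Icc x y, (θ + n * (2 * Real.pi)) / W < min Y R := fun θ hθ => by
    rw [lt_div_iff₀ Real.two_pi_pos] at hn
    rw [div_lt_iff₀ hW]
    linarith [hθ.2]
  obtain ⟨θ, hθ, hη⟩ := hz n fun θ hθ => hY _ ((hlt θ hθ).le.trans (min_le_left _ _))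
  exact ⟨_, (hlt θ hθ).trans_le (min_le_right Y R), hη⟩

end PTParams

end

theorem theorem1 (P : PTParams) (ha : P.a < 0) (hβ : P.β = 0) (hγ : 0 < P.γ)
    (h : P.γ * |Real.sinh (P.Ω * Real.pi)| < -5 * P.a * P.Ω ^ 2 * Real.pi) :
    -- a homoclinic trajectory of the uncoupled system persists
    (∃ τ₁ τ₂ : ℝ, P.IsSimpleMelnikovZero τ₁ τ₂ ∧ P.Persists τ₁ τ₂) ∧
    -- every simple zero of the Melnikov functions gives such a trajectory
    (∀ τ₁ τ₂ : ℝ, P.IsSimpleMelnikovZero τ₁ τ₂ → P.Persists τ₁ τ₂) ∧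
    -- the reduced function has simple zeros arbitrarily far out in both directions
    (∀ R : ℝ, ∃ η > R, P.IsSimpleReducedZero η) ∧
    (∀ R : ℝ, ∃ η < R, P.IsSimpleReducedZero η) ∧
    -- each of its simple zeros gives a simple zero of the Melnikov functions
    (∀ η : ℝ, P.IsSimpleReducedZero η → ∃ τ₂ : ℝ, P.IsSimpleMelnikovZero (η + τ₂) τ₂) := by
  have hΩ := PTParams.Ω_ne_zero h
  obtain ⟨η, -, hη⟩ := PTParams.exists_simpleReducedZero_gt ha hγ h 0
  obtain ⟨τ₂, hτ⟩ := hη.exists_isSimpleMelnikovZero hΩ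
  exact ⟨⟨_, _, hτ, hτ.persists ha.ne hβ hΩ⟩, fun _ _ hz => hz.persists ha.ne hβ hΩ,
    PTParams.exists_simpleReducedZero_gt ha hγ h, PTParams.exists_simpleReducedZero_lt ha hγ h,
    fun _ hz => hz.exists_isSimpleMelnikovZero hΩ⟩
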